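/- Let $\Gamma$ be a (possibly infinite, loops and multiple edges allowed) metric graph with only finitely many possible edge lengths, equipped with its length metric. Let $\Gamma'$ be a finite subgraph of $\Gamma$ in which every vertex has degree at least two (a loop counts twice). A *cycle* of a graph is a nontrivial embedded closed edge-path. A *segment* of $\Gamma'$ is a nontrivial embedded edge-path of $\Gamma'$ whose endpoints have degree at least three in $\Gamma'$ and all of whose internal vertices have degree two in $\Gamma'$. Assume that - the girth of $\Gamma$ (the infimum of the lengths of its cycles, $\infty$ if there are none) is at least $2\pi$, and - any two points $x,y$ of $\Gamma'$ (vertices or points in the interior of edges) are at distance at most $\pi$ in $\Gamma$. Then every cycle of $\Gamma'$ and every segment of $\Gamma'$ has length commensurable with $\pi$, that is, its length is a rational multiple of $\pi$. -/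

import Mathlib

/-- A metric graph, given combinatorially: vertices `V`, edges `E` (loops and parallel edges are
allowed, and both sets may be infinite), the two endpoints of every edge, and a positive length for
every edge. The choice of which endpoint is called `src` only serves to parametrise the edge. -/
structure MetricGraph (V : Type*) (E : Type*) where
  src : E → V
  tgt : E → V
  len : E → ℝ
  len_pos : ∀ e, 0 < len e

namespace MetricGraph

/-- A point of the geometric realisation: a vertex, or an interior point of an edge `e`, given by
its distance `t` from `src e` measured along `e`. -/
inductive Point {V E : Type*} (Γ : MetricGraph V E) where
  | vertex (v : V) : Point Γ
  | interior (e : E) (t : Set.Ioo (0 : ℝ) (Γ.len e)) : Point Γ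

open Classical in
/-- The characteristic map `[0, len e] → Γ` of the edge `e`, sending `0` to `src e` and `len e`
to `tgt e` (it is only used for parameters in `[0, len e]`). -/
noncomputable def point {V E : Type*} (Γ : MetricGraph V E) (e : E) (t : ℝ) : Γ.Point :=
  if h : t ∈ Set.Ioo (0 : ℝ) (Γ.len e) then Point.interior e ⟨t, h⟩
  else if t ≤ 0 then Point.vertex (Γ.src e) else Point.vertex (Γ.tgt e)

/-- `Γ.PathOfLength x y L`: there is a piecewise linear path in `Γ` from `x` to `y` of length `L`,
that is a finite concatenation of linear pieces, each of them inside one closed edge. -/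
inductive PathOfLength {V E : Type*} (Γ : MetricGraph V E) : Γ.Point → Γ.Point → ℝ → Prop
  | refl (x : Γ.Point) : PathOfLength Γ x x 0
  | step (x : Γ.Point) (L : ℝ) (e : E) (s t : ℝ)
      (hs : s ∈ Set.Icc (0 : ℝ) (Γ.len e)) (ht : t ∈ Set.Icc (0 : ℝ) (Γ.len e))
      (h : PathOfLength Γ x (Γ.point e s) L) :
      PathOfLength Γ x (Γ.point e t) (L + |s - t|)

/-- The length metric of `Γ`: the infimum of the lengths of the piecewise linear paths from `x`
to `y`. It is `∞` if `x` and `y` lie in different components. -/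
noncomputable def distance {V E : Type*} (Γ : MetricGraph V E) (x y : Γ.Point) : ENNReal :=
  ⨅ (L : ℝ) (_ : Γ.PathOfLength x y L), ENNReal.ofReal L

/-- Origin of an oriented edge; `(e, true)` is `e` run from `src e` to `tgt e`, and `(e, false)`
is `e` run from `tgt e` to `src e`. -/
def origin {V E : Type*} (Γ : MetricGraph V E) (d : E × Bool) : V :=
  if d.2 then Γ.src d.1 else Γ.tgt d.1

/-- Terminus of an oriented edge. -/
def terminus {V E : Type*} (Γ : MetricGraph V E) (d : E × Bool) : V :=
  if d.2 then Γ.tgt d.1 else Γ.src d.1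

/-- `Γ.IsEdgePath u p v`: the list `p` of oriented edges is an edge-path from `u` to `v`. -/
def IsEdgePath {V E : Type*} (Γ : MetricGraph V E) : V → List (E × Bool) → V → Prop
  | u, [], v => u = v
  | u, d :: p, v => Γ.origin d = u ∧ IsEdgePath Γ (Γ.terminus d) p v

/-- The length of an edge-path. -/
def pathLength {V E : Type*} (Γ : MetricGraph V E) (p : List (E × Bool)) : ℝ :=
  (p.map fun d => Γ.len d.1).sum

/-- A cycle: a nontrivial closed edge-path that is embedded, i.e. visits every vertex and every
edge at most once. -/
def IsCycle {V E : Type*} (Γ : MetricGraph V E) (p : List (E × Bool)) : Prop :=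
  p ≠ [] ∧ (∃ v, Γ.IsEdgePath v p v) ∧ (p.map Γ.origin).Nodup ∧ (p.map Prod.fst).Nodup

/-- There are only finitely many possible edge lengths. -/
def FinitelyManyLengths {V E : Type*} (Γ : MetricGraph V E) : Prop :=
  (Set.range Γ.len).Finite

/-- The girth, the infimum of the lengths of the cycles (`∞` for a forest), is at least `g`. -/
def GirthAtLeast {V E : Type*} (Γ : MetricGraph V E) (g : ℝ) : Prop :=
  ∀ p : List (E × Bool), Γ.IsCycle p → g ≤ Γ.pathLength p

/-- A subgraph: a set of vertices and a set of edges that contains, with an edge, its endpoints. -/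
structure Subgraph {V E : Type*} (Γ : MetricGraph V E) where
  verts : Set V
  edges : Set E
  src_mem : ∀ e ∈ edges, Γ.src e ∈ verts
  tgt_mem : ∀ e ∈ edges, Γ.tgt e ∈ verts

namespace Subgraph

/-- The points of the geometric realisation of `Γ` that lie in the subgraph. -/
def points {V E : Type*} {Γ : MetricGraph V E} (H : Γ.Subgraph) : Set Γ.Point :=
  {x | match x with
    | Point.vertex v => v ∈ H.verts
    | Point.interior e _ => e ∈ H.edges}

/-- The subgraph is finite. -/
def IsFinite {V E : Type*} {Γ : MetricGraph V E} (H : Γ.Subgraph) : Prop :=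
  H.verts.Finite ∧ H.edges.Finite

/-- The degree of `v` in the subgraph: the number of its oriented edges issuing from `v`
(so a loop counts twice). -/
noncomputable def degree {V E : Type*} {Γ : MetricGraph V E} (H : Γ.Subgraph) (v : V) : ℕ∞ :=
  {d : E × Bool | d.1 ∈ H.edges ∧ Γ.origin d = v}.encard

/-- A cycle of the subgraph. -/
def IsCycle {V E : Type*} {Γ : MetricGraph V E} (H : Γ.Subgraph) (p : List (E × Bool)) : Prop :=
  Γ.IsCycle p ∧ ∀ d ∈ p, d.1 ∈ H.edges

/-- A segment of the subgraph: a nontrivial embedded edge-path in it, whose endpoints have degree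
at least three in the subgraph and all of whose internal vertices have degree two in it. -/
def IsSegment {V E : Type*} {Γ : MetricGraph V E} (H : Γ.Subgraph) (p : List (E × Bool)) : Prop :=
  p ≠ [] ∧ (∀ d ∈ p, d.1 ∈ H.edges) ∧
    ∃ u v, Γ.IsEdgePath u p v ∧ (u :: p.map Γ.terminus).Nodup ∧
      3 ≤ H.degree u ∧ 3 ≤ H.degree v ∧
      ∀ w ∈ p.dropLast.map Γ.terminus, H.degree w = 2

end Subgraph

end MetricGraph

/-- Two nonzero real numbers are commensurable if some nonzero integer multiples of them agree,
i.e. if their ratio is rational. -/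
def Commensurable (a b : ℝ) : Prop :=
  ∃ m n : ℤ, m ≠ 0 ∧ n ≠ 0 ∧ (m : ℝ) * a = (n : ℝ) * b

/-! Put c = π. The main point is that a finite leafless set S of edges of Γ' has total length Λ in
ℚ·c (`NoLeaves.exists_rat`). The edges of a cycle form such a set. For a segment, both the edge set
of Γ' and its complement of the segment are leafless, and the length of the segment is the
difference of their totals.

Fix an additive f : ℝ → ℝ and give an a × b rectangle the f-area f(a)f(b) and a right isosceles
triangle of leg r the f-area f(r)²/2. For two edges e ≠ e' of S, every pair of interior points is
joined by a path of length at most c. The pairs joined through a reduced path Q, leaving e and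
entering e' at prescribed ends, form a corner triangle of size c - |Q| in the rectangle len e × len
e'. Girth at least 2c makes Q unique among paths shorter than c and keeps the triangles from
overlapping, so their f-areas add up to that of the rectangle (`sum_cornerArea`). When e = e', the
strip of pairs joined inside the edge has to be subtracted (`sum_cornerArea_cornerSize_self`).

Now sum over all pairs of oriented edges d, d' over S. Inclusion–exclusion writes twice the f-area
of a truncated triangle as an alternating sum of f(c - |L|)², cut off at |L| ≥ c, over L = Q, dQ,
Qd', dQd'. Regrouped by L, a path with at least two edges gets a coefficient that factors into two
nonnegative terms because S has no leaves; the empty path and the single edges are bounded below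
explicitly (`NoLeaves.le_sum_ends`). What remains is 2 f(c) f(Λ) ≤ f(Λ)² (`NoLeaves.two_mul_le_sq`).
If Λ were not in ℚ·c, some f would have f(c) = f(Λ) = 1, giving 2 ≤ 1. -/

namespace MetricGraph

/-! ### Reduced edge-paths and the girth -/

variable {V E : Type*}

/-- The oriented edge `d` run backwards. -/
def rev (d : E × Bool) : E × Bool := (d.1, !d.2)

@[simp] lemma rev_rev (d : E × Bool) : rev (rev d) = d := by simp [rev]

@[simp] lemma rev_fst (d : E × Bool) : (rev d).1 = d.1 := rfl

lemma rev_ne (d : E × Bool) : rev d ≠ d := by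
  intro h
  have := congrArg Prod.snd h
  simp [rev] at this

lemma eq_or_eq_rev {d d' : E × Bool} (h : d.1 = d'.1) : d' = d ∨ d' = rev d := by
  obtain ⟨e, b⟩ := d
  obtain ⟨e', b'⟩ := d'
  obtain rfl : e = e' := h
  cases b <;> cases b' <;> simp [rev]

variable (Γ : MetricGraph V E)

@[simp] lemma origin_rev (d : E × Bool) : Γ.origin (rev d) = Γ.terminus d := by
  obtain ⟨e, b⟩ := d
  cases b <;> simp [rev, origin, terminus]

@[simp] lemma terminus_rev (d : E × Bool) : Γ.terminus (rev d) = Γ.origin d := by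
  obtain ⟨e, b⟩ := d
  cases b <;> simp [rev, origin, terminus]

/-- `d'` may follow `d` in a path without backtracking. -/
def Next (d d' : E × Bool) : Prop := Γ.terminus d = Γ.origin d' ∧ d' ≠ rev d

/-- A list of oriented edges is reduced if it is an edge-path without backtracking. -/
def Reduced (p : List (E × Bool)) : Prop := p.IsChain Γ.Next

/-- The reversed edge-path. -/
def revPath (p : List (E × Bool)) : List (E × Bool) := (p.map rev).reverse

variable {Γ}

lemma Next.rev {d d' : E × Bool} (h : Γ.Next d d') :
    Γ.Next (MetricGraph.rev d') (MetricGraph.rev d) := by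
  refine ⟨by simp [h.1], fun hh => h.2 ?_⟩
  rw [hh]; simp

@[simp] lemma pathLength_nil : Γ.pathLength [] = 0 := by simp [pathLength]

@[simp] lemma pathLength_cons (d : E × Bool) (p : List (E × Bool)) :
    Γ.pathLength (d :: p) = Γ.len d.1 + Γ.pathLength p := by simp [pathLength]

@[simp] lemma pathLength_append (p q : List (E × Bool)) :
    Γ.pathLength (p ++ q) = Γ.pathLength p + Γ.pathLength q := by simp [pathLength]

lemma pathLength_nonneg (p : List (E × Bool)) : 0 ≤ Γ.pathLength p := by
  induction p with
  | nil => simp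
  | cons d p ih => have := Γ.len_pos d.1; simp; linarith

@[simp] lemma pathLength_revPath (p : List (E × Bool)) :
    Γ.pathLength (revPath p) = Γ.pathLength p := by
  induction p with
  | nil => simp [revPath]
  | cons d p ih =>
    have : revPath (d :: p) = revPath p ++ [rev d] := by simp [revPath]
    rw [this]; simp [ih]; ring

lemma revPath_cons (d : E × Bool) (p : List (E × Bool)) :
    revPath (d :: p) = revPath p ++ [rev d] := by simp [revPath]

lemma Reduced.revPath {p : List (E × Bool)} (h : Γ.Reduced p) :
    Γ.Reduced (MetricGraph.revPath p) := by
  unfold Reduced MetricGraph.revPath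
  rw [List.isChain_reverse, List.isChain_map]
  exact h.imp fun _ _ hab => hab.rev

lemma Reduced.left {p q : List (E × Bool)} (h : Γ.Reduced (p ++ q)) : Γ.Reduced p :=
  List.IsChain.left_of_append h

lemma Reduced.right {p q : List (E × Bool)} (h : Γ.Reduced (p ++ q)) : Γ.Reduced q :=
  List.IsChain.right_of_append h

lemma reduced_cons_cons {d d' : E × Bool} {p : List (E × Bool)} :
    Γ.Reduced (d :: d' :: p) ↔ Γ.Next d d' ∧ Γ.Reduced (d' :: p) := by
  simp [Reduced]

/-- Gluing two reduced paths along a common edge. -/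
lemma Reduced.glue {p q : List (E × Bool)} {d : E × Bool} (hp : Γ.Reduced (p ++ [d]))
    (hq : Γ.Reduced (d :: q)) : Γ.Reduced (p ++ d :: q) := by
  induction p with
  | nil => simpa using hq
  | cons a p ih =>
    cases p with
    | nil =>
      simp only [List.cons_append, List.nil_append] at hp ⊢
      exact reduced_cons_cons.2 ⟨(reduced_cons_cons.1 hp).1, hq⟩
    | cons b p =>
      simp only [List.cons_append] at hp ih ⊢
      exact reduced_cons_cons.2 ⟨(reduced_cons_cons.1 hp).1, ih (reduced_cons_cons.1 hp).2⟩

lemma isEdgePath_append {p q : List (E × Bool)} {u w : V} :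
    Γ.IsEdgePath u (p ++ q) w ↔ ∃ v, Γ.IsEdgePath u p v ∧ Γ.IsEdgePath v q w := by
  induction p generalizing u with
  | nil => simp [IsEdgePath]
  | cons d p ih => simp [IsEdgePath, ih, and_assoc]

lemma IsEdgePath.revPath {p : List (E × Bool)} {u v : V} (h : Γ.IsEdgePath u p v) :
    Γ.IsEdgePath v (MetricGraph.revPath p) u := by
  induction p generalizing u with
  | nil => exact (Eq.symm h)
  | cons d p ih =>
    rw [revPath_cons, isEdgePath_append]
    exact ⟨_, ih h.2, by simp [IsEdgePath, h.1]⟩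

/-- A reduced path is an edge-path. -/
lemma Reduced.isEdgePath {p : List (E × Bool)} {d : E × Bool} (h : Γ.Reduced (p ++ [d])) {u : V}
    (hu : ∀ x ∈ (p ++ [d]).head?, Γ.origin x = u) : Γ.IsEdgePath u (p ++ [d]) (Γ.terminus d) := by
  induction p generalizing u with
  | nil => simpa [IsEdgePath] using hu
  | cons a p ih =>
    refine ⟨hu a (by simp), ih h.tail ?_⟩
    intro x hx
    cases p with
    | nil =>
      simp only [List.nil_append, List.head?_cons, Option.mem_def, Option.some.injEq] at hx
      subst hx
      exact (reduced_cons_cons.1 h).1.1.symm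
    | cons b p =>
      simp only [List.cons_append, List.head?_cons, Option.mem_def, Option.some.injEq] at hx
      subst hx
      exact (reduced_cons_cons.1 h).1.1.symm

/-- The middle part of a reduced path, as an edge-path. -/
lemma Reduced.isEdgePath_mid {p : List (E × Bool)} {d d' : E × Bool}
    (h : Γ.Reduced (d :: p ++ [d'])) : Γ.IsEdgePath (Γ.terminus d) p (Γ.origin d') := by
  have h1 := h.isEdgePath (u := Γ.origin d) (by simp)
  rw [List.cons_append] at h1
  obtain ⟨v, hv, hv'⟩ := isEdgePath_append.1 h1.2
  rw [hv'.1]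
  exact hv

lemma reduced_cons_of_isEdgePath {p : List (E × Bool)} {d : E × Bool} {v : V}
    (hp : Γ.Reduced p) (hpath : Γ.IsEdgePath (Γ.terminus d) p v)
    (hne : p.head? ≠ some (rev d)) : Γ.Reduced (d :: p) := by
  cases p with
  | nil => simp [Reduced]
  | cons a p => exact reduced_cons_cons.2 ⟨⟨hpath.1.symm, fun h => hne (by simp [h])⟩, hp⟩

lemma exists_split_of_not_nodup_map {α β : Type*} (f : α → β) {p : List α}
    (h : ¬ (p.map f).Nodup) : ∃ A B C d d', p = A ++ d :: B ++ d' :: C ∧ f d = f d' := by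
  induction p with
  | nil => simp at h
  | cons a p ihp =>
    rw [List.map_cons, List.nodup_cons, not_and_or, not_not] at h
    rcases h with h | h
    · obtain ⟨d', hd', hf⟩ := List.mem_map.1 h
      obtain ⟨B, C, rfl⟩ := List.append_of_mem hd'
      exact ⟨[], B, C, a, d', by simp, hf.symm⟩
    · obtain ⟨A, B, C, d, d', rfl, hf⟩ := ihp h
      exact ⟨a :: A, B, C, d, d', by simp, hf⟩

/-- A nonempty closed reduced path contains a cycle, so it is at least as long as the girth. -/
lemma girth_le_of_reduced {g : ℝ} (hg : Γ.GirthAtLeast g) :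
    ∀ (n : ℕ) (p : List (E × Bool)), p.length ≤ n → p ≠ [] → Γ.Reduced p →
      (∃ v, Γ.IsEdgePath v p v) → g ≤ Γ.pathLength p := by
  intro n
  induction n with
  | zero => intro p hn hp; simp at hn; exact absurd hn hp
  | succ n ih =>
    intro p hn hp hred hclosed
    by_cases hv : (p.map Γ.origin).Nodup
    · refine hg p ⟨hp, hclosed, hv, ?_⟩
      by_contra hne
      obtain ⟨A, B, C, d, d', rfl, hdd⟩ := exists_split_of_not_nodup_map _ hne
      rcases eq_or_eq_rev hdd with rfl | rfl
      · simp [List.nodup_append] at hv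
      · have h1 : Γ.Reduced (d :: (B ++ rev d :: C)) := by
          rw [List.append_assoc] at hred; simpa using hred.right
        cases B with
        | nil => exact (reduced_cons_cons.1 h1).1.2 rfl
        | cons b B =>
          have h2 := (reduced_cons_cons.1 h1).1.1
          simp only [List.map_append, List.map_cons, origin_rev, h2] at hv
          simp [List.nodup_append] at hv
    · obtain ⟨A, B, C, d, d', rfl, hdd⟩ := exists_split_of_not_nodup_map _ hv
      obtain ⟨v, hv⟩ := hclosed
      have h3 : g ≤ Γ.pathLength (d :: B) := by
        refine ih _ ?_ (by simp) ?_ ⟨Γ.origin d, ?_⟩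
        · simp at hn ⊢; omega
        · exact hred.left.right
        · rw [List.append_assoc, isEdgePath_append] at hv
          obtain ⟨w, -, hw⟩ := hv
          rw [isEdgePath_append] at hw
          obtain ⟨w', hw1, hw2⟩ := hw
          have e1 := hw1.1
          have e2 := hw2.1
          subst e1
          rw [← e2, ← hdd] at hw1
          exact hw1
      have := Γ.pathLength_nonneg A
      have := Γ.pathLength_nonneg (d' :: C)
      simp only [pathLength_append]
      linarith

lemma GirthAtLeast.le_of_closed {g : ℝ} (hg : Γ.GirthAtLeast g) {p : List (E × Bool)} {v : V}
    (hp : p ≠ []) (hred : Γ.Reduced p) (hclosed : Γ.IsEdgePath v p v) : g ≤ Γ.pathLength p :=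
  girth_le_of_reduced hg _ p le_rfl hp hred ⟨v, hclosed⟩

/-- Two different reduced paths with the same endpoints. -/
lemma GirthAtLeast.le_add {g : ℝ} (hg : Γ.GirthAtLeast g) {p q : List (E × Bool)} {u v : V}
    (hp : Γ.Reduced p) (hq : Γ.Reduced q) (hpp : Γ.IsEdgePath u p v) (hqp : Γ.IsEdgePath u q v)
    (hne : p ≠ q) : g ≤ Γ.pathLength p + Γ.pathLength q := by
  induction p generalizing q u with
  | nil =>
    obtain rfl : u = v := hpp
    simpa using hg.le_of_closed (Ne.symm hne) hq hqp
  | cons a p ih =>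
    cases q with
    | nil =>
      obtain rfl : u = v := hqp
      simpa using hg.le_of_closed hne hp hpp
    | cons b q =>
      by_cases hab : a = b
      · subst hab
        have := ih hp.tail hq.tail hpp.2 hqp.2 (by simpa using hne)
        have := Γ.len_pos a.1
        simp only [pathLength_cons, List.tail_cons] at *
        linarith
      -- Since the first edges differ, running `a :: p` backwards and then `b :: q` does not
      -- backtrack at `u`, and the result is a closed reduced path.
      · have h1 : Γ.Reduced (rev a :: b :: q) :=
          reduced_cons_cons.2 ⟨⟨by simp [hpp.1, hqp.1], by simpa using Ne.symm hab⟩, hq⟩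
        have h2 : Γ.Reduced (revPath p ++ [rev a]) := by
          rw [← revPath_cons]; exact hp.revPath
        have h3 := hg.le_of_closed (v := v) (by simp) (h2.glue h1) (by
          have h4 := hpp.revPath
          rw [revPath_cons] at h4
          have h5 := isEdgePath_append.2 ⟨_, h4, hqp⟩
          simpa using h5)
        simp at h3 ⊢
        linarith

end MetricGraph

/-! ### Paths between interior points of edges -/

namespace MetricGraph

variable {V E : Type*} {Γ : MetricGraph V E}

/-- The distance along `d` from its origin to the point with parameter `t` on the edge of `d`. -/
def pos (Γ : MetricGraph V E) (d : E × Bool) (t : ℝ) : ℝ := if d.2 then t else Γ.len d.1 - t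

lemma pos_rev (d : E × Bool) (t : ℝ) : Γ.pos (rev d) t = Γ.len d.1 - Γ.pos d t := by
  obtain ⟨e, b⟩ := d
  cases b <;> simp [pos, rev]

lemma abs_pos_sub_pos (d : E × Bool) (s t : ℝ) : |Γ.pos d s - Γ.pos d t| = |s - t| := by
  obtain ⟨e, b⟩ := d
  cases b
  · simp only [pos]
    rw [abs_sub_comm s t]
    congr 1
    simp
  · simp [pos]

lemma pos_mem (d : E × Bool) {t : ℝ} (ht : t ∈ Set.Ioo 0 (Γ.len d.1)) :
    Γ.pos d t ∈ Set.Ioo 0 (Γ.len d.1) := by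
  obtain ⟨e, b⟩ := d
  obtain ⟨h1, h2⟩ := ht
  cases b <;> simp [pos] <;> constructor <;> simp_all

lemma exists_length_lt {x y : Γ.Point} {c ε : ℝ} (hc : 0 ≤ c) (hε : 0 < ε)
    (h : Γ.distance x y ≤ ENNReal.ofReal c) : ∃ L, Γ.PathOfLength x y L ∧ L < c + ε := by
  have h1 : Γ.distance x y < ENNReal.ofReal (c + ε) :=
    h.trans_lt ((ENNReal.ofReal_lt_ofReal_iff (by linarith)).2 (by linarith))
  unfold distance at h1
  simp only [iInf_lt_iff] at h1
  obtain ⟨L, hL, hlt⟩ := h1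
  exact ⟨L, hL, (ENNReal.ofReal_lt_ofReal_iff (by linarith)).1 hlt⟩

/-- The points `s` of `e` and `t` of `e'` are joined, either inside one edge or by an edge-path
with two partial end edges, by a path of length at most `L`. -/
def Joined (Γ : MetricGraph V E) (e : E) (s : ℝ) (e' : E) (t L : ℝ) : Prop :=
  (e = e' ∧ |s - t| ≤ L) ∨ ∃ d d' Q, d.1 = e ∧ d'.1 = e' ∧
    Γ.IsEdgePath (Γ.terminus d) Q (Γ.origin d') ∧
    Γ.pos (rev d) s + Γ.pathLength Q + Γ.pos d' t ≤ L

/-- The point `s` of `e` and the vertex `v` are joined by an edge-path with a partial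
first edge of length at most `L`. -/
def JoinedVertex (Γ : MetricGraph V E) (e : E) (s : ℝ) (v : V) (L : ℝ) : Prop :=
  ∃ d Q, d.1 = e ∧ Γ.IsEdgePath (Γ.terminus d) Q v ∧ Γ.pos (rev d) s + Γ.pathLength Q ≤ L

/-- The point `s` of `e` and the point `y` are joined by a path of length at most `L`. -/
def JoinedPoint (Γ : MetricGraph V E) (e : E) (s : ℝ) (L : ℝ) : Γ.Point → Prop
  | Point.vertex v => Γ.JoinedVertex e s v L
  | Point.interior e' t => Γ.Joined e s e' t L

lemma joined_of_origin {e : E} {s L : ℝ} {d' : E × Bool} {t : ℝ} (ht : Γ.pos d' t = 0)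
    (h : Γ.JoinedVertex e s (Γ.origin d') L) : Γ.Joined e s d'.1 t L := by
  obtain ⟨d, Q, hd, hQ, hL⟩ := h
  exact Or.inr ⟨d, d', Q, hd, rfl, hQ, by linarith⟩

lemma joinedVertex_origin {e : E} {s L : ℝ} {d' : E × Bool} {t : ℝ}
    (ht : Γ.pos d' t = 0) (h : Γ.Joined e s d'.1 t L) : Γ.JoinedVertex e s (Γ.origin d') L := by
  rcases h with ⟨rfl, h⟩ | ⟨d, d'', Q, hd, hd', hQ, hL⟩
  · refine ⟨rev d', [], rfl, by simp [IsEdgePath], ?_⟩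
    rw [← abs_pos_sub_pos d', ht, sub_zero] at h
    simpa using (le_abs_self _).trans h
  · rcases eq_or_eq_rev hd'.symm with rfl | rfl
    · exact ⟨d, Q, hd, hQ, by linarith⟩
    · refine ⟨d, Q ++ [rev d'], hd, isEdgePath_append.2 ⟨_, hQ, by simp [IsEdgePath]⟩, ?_⟩
      rw [pos_rev d', ht] at hL
      simp
      linarith

lemma joined_of_joinedPoint {e e' : E} {s t L : ℝ} (ht : t ∈ Set.Icc 0 (Γ.len e'))
    (h : Γ.JoinedPoint e s L (Γ.point e' t)) : Γ.Joined e s e' t L := by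
  unfold point at h
  split_ifs at h with h1 h2
  · exact h
  · exact joined_of_origin (d' := (e', true)) (by simp [pos]; linarith [ht.1]) h
  · have : t = Γ.len e' := by
      by_contra hne
      exact h1 ⟨not_le.1 h2, lt_of_le_of_ne ht.2 hne⟩
    exact joined_of_origin (d' := (e', false)) (by simp [pos, this]) h

lemma joinedPoint_of_joined {e e' : E} {s t L : ℝ}
    (ht : t ∈ Set.Icc 0 (Γ.len e'))
    (h : Γ.Joined e s e' t L) : Γ.JoinedPoint e s L (Γ.point e' t) := by
  unfold point
  split_ifs with h1 h2
  · exact h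
  · exact joinedVertex_origin (d' := (e', true)) (by simp [pos]; linarith [ht.1]) h
  · have : t = Γ.len e' := by
      by_contra hne
      exact h1 ⟨not_le.1 h2, lt_of_le_of_ne ht.2 hne⟩
    exact joinedVertex_origin (d' := (e', false)) (by simp [pos, this]) h

lemma Joined.move {e e' : E} {s t t' L : ℝ} (h : Γ.Joined e s e' t L) :
    Γ.Joined e s e' t' (L + |t - t'|) := by
  rcases h with ⟨rfl, h⟩ | ⟨d, d', Q, hd, hd', hQ, hL⟩
  · exact Or.inl ⟨rfl, (abs_sub_le s t t').trans (by linarith)⟩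
  · refine Or.inr ⟨d, d', Q, hd, hd', hQ, ?_⟩
    rw [abs_sub_comm, ← abs_pos_sub_pos d']
    have := le_abs_self (Γ.pos d' t' - Γ.pos d' t)
    linarith

/-- A linear piece only shifts the parameter on the last edge. When a piece starts at a vertex, the
path so far is reread as ending at the corresponding end of the new edge. -/
lemma PathOfLength.joinedPoint {e : E} {s : Set.Ioo (0 : ℝ) (Γ.len e)} {y : Γ.Point} {L : ℝ}
    (h : Γ.PathOfLength (Point.interior e s) y L) : Γ.JoinedPoint e s L y := by
  generalize hx : Point.interior e s = x at h
  induction h with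
  | refl => subst hx; exact Or.inl ⟨rfl, by simp⟩
  | step L e' t t' ht ht' h ih =>
    exact joinedPoint_of_joined ht' (joined_of_joinedPoint ht ih).move

/-- The lengths of the edge-paths form a discrete set. -/
lemma FinitelyManyLengths.finite_pathLength (h : Γ.FinitelyManyLengths) (C : ℝ) :
    {r | r ≤ C ∧ ∃ Q, r = Γ.pathLength Q}.Finite := by
  by_cases hE : IsEmpty E
  · refine (Set.finite_singleton (0 : ℝ)).subset ?_
    rintro r ⟨-, Q, rfl⟩
    cases Q with
    | nil => simp
    | cons d Q => exact (hE.false d.1).elim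
  rw [not_isEmpty_iff] at hE
  -- A shortest edge exists, so a bound on the length of a path bounds its number of edges; then
  -- only finitely many sums of lengths are possible.
  obtain ⟨m, ⟨e, rfl⟩, hm⟩ := h.exists_minimal (Set.range_nonempty Γ.len)
  have hle : ∀ e', Γ.len e ≤ Γ.len e' := fun e' => by
    rcases le_total (Γ.len e) (Γ.len e') with h1 | h1
    · exact h1
    · exact hm ⟨e', rfl⟩ h1
  have hpos := Γ.len_pos e
  obtain ⟨n, hn⟩ := exists_nat_gt (C / Γ.len e)
  have : Finite (Set.range Γ.len) := h
  refine ((List.finite_length_le (Set.range Γ.len) n).image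
    (fun l => (l.map Subtype.val).sum)).subset ?_
  rintro r ⟨hr, Q, rfl⟩
  refine ⟨Q.map fun d => ⟨Γ.len d.1, d.1, rfl⟩, ?_, by simp [pathLength, Function.comp_def]⟩
  have hlen : (Q.length : ℝ) * Γ.len e ≤ Γ.pathLength Q := by
    clear hr
    induction Q with
    | nil => simp
    | cons d Q ih => have := hle d.1; simp; linarith
  have : (Q.length : ℝ) < n := by
    refine lt_of_le_of_lt ?_ hn
    rw [le_div_iff₀ hpos]; linarith
  simpa using (by exact_mod_cast this.le : Q.length ≤ n)

lemma FinitelyManyLengths.exists_gap (h : Γ.FinitelyManyLengths) (c : ℝ) :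
    ∃ ε > 0, ∀ Q, Γ.pathLength Q < c + ε → Γ.pathLength Q ≤ c := by
  have hfin : {r | (r ≤ c + 1 ∧ ∃ Q, r = Γ.pathLength Q) ∧ c < r}.Finite :=
    (h.finite_pathLength (c + 1)).subset fun r hr => hr.1
  by_cases hne : {r | (r ≤ c + 1 ∧ ∃ Q, r = Γ.pathLength Q) ∧ c < r}.Nonempty
  · obtain ⟨m, hm, hmin⟩ := hfin.exists_minimal hne
    refine ⟨m - c, sub_pos.2 hm.2, fun Q hQ => ?_⟩
    by_contra hc
    rw [not_le] at hc
    have h1 : Γ.pathLength Q < m := by linarith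
    have := hmin ⟨⟨h1.le.trans hm.1.1, Q, rfl⟩, hc⟩ h1.le
    linarith
  · refine ⟨1, one_pos, fun Q hQ => ?_⟩
    by_contra hc
    exact hne ⟨_, ⟨hQ.le, Q, rfl⟩, not_le.1 hc⟩

/-- The infimum in the distance of two interior points is attained. -/
lemma FinitelyManyLengths.joined (h : Γ.FinitelyManyLengths) {e e' : E}
    {s : Set.Ioo (0 : ℝ) (Γ.len e)} {t : Set.Ioo (0 : ℝ) (Γ.len e')} {c : ℝ} (hc : 0 ≤ c)
    (hd : Γ.distance (Point.interior e s) (Point.interior e' t) ≤ ENNReal.ofReal c) :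
    Γ.Joined e s e' t c := by
  -- Once the orientations of the two partial edges are fixed, only the length of the middle path
  -- varies, and it has a gap above the critical value. Four orientations give four gaps.
  choose ε hε hgap using fun d d' : Bool =>
    h.exists_gap (c - Γ.pos (rev (e, d)) s - Γ.pos (e', d') t)
  obtain ⟨δ, hδ, hδle⟩ : ∃ δ > 0, ∀ d d', δ ≤ ε d d' :=
    ⟨min (min (ε true true) (ε true false)) (min (ε false true) (ε false false)), by
      simp [hε], by
      intro d d'; cases d <;> cases d' <;> simp⟩
  by_cases hdir : e = e' ∧ |(s : ℝ) - t| ≤ c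
  · exact Or.inl hdir
  obtain ⟨δ', hδ', hδle'⟩ : ∃ δ' > 0, δ' ≤ δ ∧ ¬ (e = e' ∧ |(s : ℝ) - t| ≤ c + δ' / 2) := by
    by_cases hee : e = e'
    · have : c < |(s : ℝ) - t| := by
        by_contra hcon; exact hdir ⟨hee, not_lt.1 hcon⟩
      refine ⟨min δ (|(s : ℝ) - t| - c), lt_min hδ (sub_pos.2 this), min_le_left _ _, ?_⟩
      rintro ⟨-, h1⟩
      have := min_le_right δ (|(s : ℝ) - t| - c)
      linarith
    · exact ⟨δ, hδ, le_rfl, fun h => hee h.1⟩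
  obtain ⟨L, hL, hlt⟩ := exists_length_lt hc (half_pos hδ') hd
  rcases hL.joinedPoint with ⟨rfl, h1⟩ | ⟨d, d', Q, rfl, rfl, hQ, hle⟩
  · exact absurd ⟨rfl, h1.trans hlt.le⟩ hδle'.2
  · refine Or.inr ⟨d, d', Q, rfl, rfl, hQ, ?_⟩
    have := hgap d.2 d'.2 Q (by have := hδle d.2 d'.2; linarith [hδle'.1])
    linarith

/-- Cancelling a backtrack keeps the endpoints and only shortens the path. -/
lemma exists_reduced {Q : List (E × Bool)} {u v : V} (h : Γ.IsEdgePath u Q v) :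
    ∃ Q', Γ.IsEdgePath u Q' v ∧ Γ.Reduced Q' ∧ Γ.pathLength Q' ≤ Γ.pathLength Q := by
  induction Q generalizing u with
  | nil => exact ⟨[], h, by simp [Reduced], le_rfl⟩
  | cons d Q ih =>
    obtain ⟨Q', h1, h2, h3⟩ := ih h.2
    by_cases hh : Q'.head? = some (rev d)
    · obtain ⟨Q'', rfl⟩ := List.head?_eq_some_iff.1 hh
      refine ⟨Q'', ?_, h2.tail, ?_⟩
      · have := h1.2
        rwa [terminus_rev, h.1] at this
      · have := Γ.len_pos d.1
        simp at h3 ⊢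
        linarith
    · exact ⟨d :: Q', ⟨h.1, h1⟩, reduced_cons_of_isEdgePath h2 h1 hh, by simpa using h3⟩

/-- A shortest path between two interior points is reduced. -/
lemma Joined.exists_reduced {e e' : E} {s t L : ℝ} (hs : s ∈ Set.Ioo 0 (Γ.len e))
    (ht : t ∈ Set.Ioo 0 (Γ.len e')) (h : Γ.Joined e s e' t L) :
    (e = e' ∧ |s - t| ≤ L) ∨ ∃ d d' Q, d.1 = e ∧ d'.1 = e' ∧
      Γ.Reduced (d :: Q ++ [d']) ∧ Γ.pos (rev d) s + Γ.pathLength Q + Γ.pos d' t ≤ L := by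
  rcases h with h | ⟨d, d', Q, rfl, rfl, hQ, hL⟩
  · exact Or.inl h
  obtain ⟨Q, hpath, hred, hle⟩ := MetricGraph.exists_reduced hQ
  have hL1 : Γ.pos (rev d) s + Γ.pathLength Q + Γ.pos d' t ≤ L := by linarith
  clear hQ hle hL
  obtain ⟨d1, Q1, hd1, hpath1, hred1, hle1⟩ : ∃ d1 Q1, d1.1 = d.1 ∧
      Γ.IsEdgePath (Γ.terminus d1) Q1 (Γ.origin d') ∧ Γ.Reduced (d1 :: Q1) ∧
      Γ.pos (rev d1) s + Γ.pathLength Q1 + Γ.pos d' t ≤ L := by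
    by_cases hh : Q.head? = some (rev d)
    · obtain ⟨Q', rfl⟩ := List.head?_eq_some_iff.1 hh
      refine ⟨rev d, Q', rfl, hpath.2, hred, ?_⟩
      have := (pos_mem (rev d) hs).1
      simp only [pathLength_cons, rev_fst] at *
      rw [pos_rev (rev d)]
      simp only [rev_fst]
      linarith
    · exact ⟨d, Q, rfl, hpath, reduced_cons_of_isEdgePath hred hpath hh, hL1⟩
  rw [← hd1] at hs ⊢
  -- The far end is treated by reversing the path: either there is no backtrack into `d'`, or the
  -- last edge is `rev d'` and can be shortened to a partial edge.
  have hrr : Γ.Reduced (rev d' :: revPath (d1 :: Q1)) ∨ ∃ A, d1 :: Q1 = A ++ [rev d'] := by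
    by_cases hh : (revPath (d1 :: Q1)).head? = some (rev (rev d'))
    · right
      rw [rev_rev] at hh
      obtain ⟨Q', h'⟩ := List.head?_eq_some_iff.1 hh
      refine ⟨revPath Q', ?_⟩
      have : revPath (revPath (d1 :: Q1)) = revPath (d' :: Q') := by rw [h']
      rw [revPath_cons d'] at this
      rw [← this]
      simp [revPath, List.map_reverse, Function.comp_def]
    · left
      refine reduced_cons_of_isEdgePath (v := Γ.origin d1) hred1.revPath ?_ hh
      rw [terminus_rev]
      exact IsEdgePath.revPath ⟨rfl, hpath1⟩
  rcases hrr with hrr | ⟨A, hA⟩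
  · refine Or.inr ⟨d1, d', Q1, rfl, rfl, ?_, hle1⟩
    have := hrr.revPath
    rw [revPath_cons, rev_rev] at this
    simpa [revPath, List.map_reverse, Function.comp_def] using this
  · cases A with
    | nil =>
      -- Here the path goes out to an end of `e` over the whole edge and back, so the two points are
      -- joined inside that edge.
      simp only [List.nil_append, List.cons.injEq] at hA
      obtain ⟨rfl, rfl⟩ := hA
      left
      refine ⟨rfl, ?_⟩
      rw [rev_rev] at hle1
      rw [← abs_pos_sub_pos d', abs_le]
      have := (pos_mem d' hs).1
      have := (pos_mem d' ht).1
      simp at hle1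
      constructor <;> linarith
    | cons a A =>
      simp only [List.cons_append, List.cons.injEq] at hA
      obtain ⟨rfl, rfl⟩ := hA
      refine Or.inr ⟨d1, rev d', A, rfl, rfl, hred1, ?_⟩
      have := (pos_mem d' ht).1
      rw [pos_rev d']
      simp only [pathLength_append, pathLength_cons, pathLength_nil, rev_fst] at hle1
      linarith

end MetricGraph

/-! ### Areas of corner triangles in a rectangle -/

namespace MetricGraph

/-- The square of `f r`, cut off at `r ≤ 0`. -/
noncomputable def cutSq (f : ℝ →+ ℝ) (r : ℝ) : ℝ := if 0 < r then f r ^ 2 else 0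

lemma cutSq_nonneg (f : ℝ →+ ℝ) (r : ℝ) : 0 ≤ cutSq f r := by
  unfold cutSq; split_ifs <;> positivity

lemma cutSq_of_pos (f : ℝ →+ ℝ) {r : ℝ} (hr : 0 < r) : cutSq f r = f r ^ 2 := if_pos hr

lemma cutSq_of_nonneg (f : ℝ →+ ℝ) {r : ℝ} (hr : 0 ≤ r) : cutSq f r = f r ^ 2 := by
  rcases hr.eq_or_lt with rfl | hr
  · simp [cutSq]
  · exact if_pos hr

lemma cutSq_of_nonpos (f : ℝ →+ ℝ) {r : ℝ} (hr : r ≤ 0) : cutSq f r = 0 := if_neg hr.not_gt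

lemma cutSq_add_cutSq_neg (f : ℝ →+ ℝ) (r : ℝ) : cutSq f r + cutSq f (-r) = f r ^ 2 := by
  rcases le_total 0 r with h | h
  · rw [cutSq_of_nonneg f h, cutSq_of_nonpos f (by linarith), add_zero]
  · rw [cutSq_of_nonpos f h, cutSq_of_nonneg f (by linarith), map_neg]; ring

/-- Twice the `f`-area of the corner triangle of size `R` in an `a × b` rectangle. -/
noncomputable def cornerArea (f : ℝ →+ ℝ) (a b R : ℝ) : ℝ :=
  cutSq f R - cutSq f (R - a) - cutSq f (R - b) + cutSq f (R - a - b)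

lemma cornerArea_zero (f : ℝ →+ ℝ) {a b : ℝ} (ha : 0 < a) (hb : 0 < b) :
    cornerArea f a b 0 = 0 := by
  unfold cornerArea
  rw [cutSq_of_nonpos f le_rfl, cutSq_of_nonpos f (by linarith), cutSq_of_nonpos f (by linarith),
    cutSq_of_nonpos f (by linarith)]
  ring

lemma cornerArea_of_le (f : ℝ →+ ℝ) {a b R : ℝ} (ha : 0 < a) (hb : 0 < b) (hR : a + b ≤ R) :
    cornerArea f a b R = 2 * f a * f b := by
  unfold cornerArea
  rw [cutSq_of_nonneg f (by linarith), cutSq_of_nonneg f (by linarith),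
    cutSq_of_nonneg f (by linarith), cutSq_of_nonneg f (by linarith)]
  simp only [map_sub]
  ring

/-- Opposite corner triangles with R + R' = a + b share their hypotenuse line and fill the
rectangle. The cut-off terms pair up as arguments r and -r, so the identity needs no monotonicity of
f. -/
lemma cornerArea_add (f : ℝ →+ ℝ) {a b R R' : ℝ} (hR : 0 < R) (hR' : 0 < R') (h : R + R' = a + b) :
    cornerArea f a b R + cornerArea f a b R' = 2 * f a * f b := by
  unfold cornerArea
  have h1 := cutSq_add_cutSq_neg f (R - a)
  have h2 := cutSq_add_cutSq_neg f (R - b)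
  rw [show -(R - a) = R' - b by linarith] at h1
  rw [show -(R - b) = R' - a by linarith] at h2
  rw [cutSq_of_pos f hR, cutSq_of_pos f hR', cutSq_of_nonpos f (r := R - a - b) (by linarith),
    cutSq_of_nonpos f (r := R' - a - b) (by linarith)]
  have h3 : f R' = f a + f b - f R := by rw [← map_add, ← h, map_add]; ring
  rw [map_sub] at h1 h2
  rw [h3]
  linear_combination -h1 - h2

/-- The distance of the point `s` of `[0, a]` from `a` (`true`) or `0` (`false`). -/
def fromEnd (a s : ℝ) (i : Bool) : ℝ := if i then a - s else s

/-- The four corner triangles, of sizes p, q, r, w in cyclic order, leave an interior point free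
unless one of them or an opposite pair fills the rectangle: adjacent triangles fit along their
common side, so they cannot close the gap. -/
lemma exists_uncovered {a b p q r w : ℝ} (ha : 0 < a) (hb : 0 < b)
    (hp : 0 ≤ p) (hq : 0 ≤ q) (hr : 0 ≤ r) (hw : 0 ≤ w)
    (hp' : p < a + b) (hq' : q < a + b) (hr' : r < a + b) (hw' : w < a + b)
    (hpr : p + r < a + b) (hqw : q + w < a + b)
    (hpq : 0 < p → 0 < q → p + q ≤ a) (hqr : 0 < q → 0 < r → q + r ≤ b)
    (hrw : 0 < r → 0 < w → r + w ≤ a) (hwp : 0 < w → 0 < p → w + p ≤ b) :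
    ∃ s ∈ Set.Ioo 0 a, ∃ t ∈ Set.Ioo 0 b,
      p < s + t ∧ q < (a - s) + t ∧ r < (a - s) + (b - t) ∧ w < s + (b - t) := by
  have k1 : p + q < a + 2 * b ∧ p + q < 2 * a + b := by
    rcases hp.eq_or_lt with rfl | h1
    · constructor <;> linarith
    rcases hq.eq_or_lt with rfl | h2
    · constructor <;> linarith
    have := hpq h1 h2
    constructor <;> linarith
  have k2 : q + r < a + 2 * b ∧ q + r < 2 * a + b := by
    rcases hq.eq_or_lt with rfl | h1
    · constructor <;> linarith
    rcases hr.eq_or_lt with rfl | h2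
    · constructor <;> linarith
    have := hqr h1 h2
    constructor <;> linarith
  have k3 : r + w < a + 2 * b ∧ r + w < 2 * a + b := by
    rcases hr.eq_or_lt with rfl | h1
    · constructor <;> linarith
    rcases hw.eq_or_lt with rfl | h2
    · constructor <;> linarith
    have := hrw h1 h2
    constructor <;> linarith
  have k4 : w + p < a + 2 * b ∧ w + p < 2 * a + b := by
    rcases hw.eq_or_lt with rfl | h1
    · constructor <;> linarith
    rcases hp.eq_or_lt with rfl | h2
    · constructor <;> linarith
    have := hwp h1 h2
    constructor <;> linarith
  -- In the coordinates u = t - s, v = t + s the hypotenuses are parallel to the axes. The bounds on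
  -- u are those on u alone together with those left after eliminating v.
  obtain ⟨u, hu1, hu2⟩ : ∃ u, max (q - a) (max (p - 2 * a) (r - a - b)) < u ∧
      u < min (b - w) (min (2 * b - p) (a + b - r)) := by
    apply exists_between
    simp only [max_lt_iff, lt_min_iff]
    refine ⟨⟨?_, ?_, ?_⟩, ⟨?_, ?_, ?_⟩, ⟨?_, ?_, ?_⟩⟩ <;> linarith
  simp only [max_lt_iff] at hu1
  simp only [lt_min_iff] at hu2
  obtain ⟨hu1a, hu1b, hu1c⟩ := hu1
  obtain ⟨hu2a, hu2b, hu2c⟩ := hu2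
  obtain ⟨v, hv1, hv2⟩ : ∃ v, max p (max u (-u)) < v ∧
      v < min (a + b - r) (min (u + 2 * a) (2 * b - u)) := by
    apply exists_between
    simp only [max_lt_iff, lt_min_iff]
    refine ⟨⟨?_, ?_, ?_⟩, ⟨?_, ?_, ?_⟩, ⟨?_, ?_, ?_⟩⟩ <;> linarith
  simp only [max_lt_iff] at hv1
  simp only [lt_min_iff] at hv2
  obtain ⟨hv1a, hv1b, hv1c⟩ := hv1
  obtain ⟨hv2a, hv2b, hv2c⟩ := hv2
  refine ⟨(v - u) / 2, ⟨by linarith, by linarith⟩, (v + u) / 2, ⟨by linarith, by linarith⟩,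
    by linarith, by linarith, by linarith, by linarith⟩

/-- A rectangle covered by corner triangles with disjoint interiors: either one of them
is everything, or there are two opposite ones. -/
lemma sum_cornerArea (f : ℝ →+ ℝ) {a b : ℝ} (ha : 0 < a) (hb : 0 < b) (R : Bool → Bool → ℝ)
    (hR : ∀ i j, 0 ≤ R i j)
    (hadj₁ : ∀ i j, 0 < R i j → 0 < R (!i) j → R i j + R (!i) j ≤ a)
    (hadj₂ : ∀ i j, 0 < R i j → 0 < R i (!j) → R i j + R i (!j) ≤ b)
    (hopp : ∀ i j, 0 < R i j → 0 < R (!i) (!j) → R i j + R (!i) (!j) ≤ a + b)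
    (hcover : ∀ s ∈ Set.Ioo 0 a, ∀ t ∈ Set.Ioo 0 b,
      ∃ i j, fromEnd a s i + fromEnd b t (!j) ≤ R i j) :
    ∑ i, ∑ j, cornerArea f a b (R i j) = 2 * f a * f b := by
  have zero {i j} (h : ¬ 0 < R i j) : R i j = 0 := le_antisymm (not_lt.1 h) (hR i j)
  -- In either filling configuration the non-overlap conditions force all remaining triangles to
  -- have size zero.
  have key : ∀ i j, a + b ≤ R i j ∨ (0 < R i j ∧ 0 < R (!i) (!j) ∧ R i j + R (!i) (!j) = a + b) →
      ∑ i, ∑ j, cornerArea f a b (R i j) = 2 * f a * f b := by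
    intro i j h
    have hs : ∑ i, ∑ j, cornerArea f a b (R i j) = cornerArea f a b (R i j) +
        cornerArea f a b (R (!i) j) + cornerArea f a b (R i (!j)) +
        cornerArea f a b (R (!i) (!j)) := by
      cases i <;> cases j <;> simp <;> ring
    rw [hs]
    rcases h with h | ⟨h1, h2, h3⟩
    · have hpos : 0 < R i j := by linarith
      rw [zero (i := !i) (j := j) fun hh => by have := hadj₁ i j hpos hh; linarith,
        zero (i := i) (j := !j) fun hh => by have := hadj₂ i j hpos hh; linarith,
        zero (i := !i) (j := !j) fun hh => by have := hopp i j hpos hh; linarith,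
        cornerArea_zero f ha hb, cornerArea_of_le f ha hb h]
      ring
    · rw [zero (i := !i) (j := j) fun hh => by
          have := hadj₁ i j h1 hh; have := hadj₂ (!i) j hh h2; linarith,
        zero (i := i) (j := !j) fun hh => by
          have := hadj₂ i j h1 hh; have := hadj₁ i (!j) hh h2; linarith,
        cornerArea_zero f ha hb, ← cornerArea_add f h1 h2 h3]
      ring
  by_contra hne
  have hlt : ∀ i j, R i j < a + b := fun i j =>
    not_le.1 fun h => hne (key i j (Or.inl h))
  have hlt2 : ∀ i j, R i j + R (!i) (!j) < a + b := fun i j => by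
    by_contra h
    rw [not_lt] at h
    by_cases h1 : 0 < R i j
    · by_cases h2 : 0 < R (!i) (!j)
      · exact hne (key i j (Or.inr ⟨h1, h2, le_antisymm (hopp i j h1 h2) h⟩))
      · have := hlt i j; have := zero h2; linarith
    · have := hlt (!i) (!j); have := zero h1; linarith
  obtain ⟨s, hs, t, ht, h1, h2, h3, h4⟩ := exists_uncovered ha hb (hR false true) (hR true true)
    (hR true false) (hR false false) (hlt _ _) (hlt _ _) (hlt _ _) (hlt _ _)
    (hlt2 false true) (hlt2 true true)
    (hadj₁ false true) (hadj₂ true true) (hadj₁ true false) (hadj₂ false false)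
  obtain ⟨i, j, hij⟩ := hcover s hs t ht
  cases i <;> cases j <;> simp [fromEnd] at hij <;> linarith

end MetricGraph

/-! ### The corner triangles of a pair of edges -/

namespace MetricGraph

variable {V E : Type*} {Γ : MetricGraph V E}

lemma not_reduced_rev_cons {d : E × Bool} {p : List (E × Bool)} :
    ¬ Γ.Reduced (rev d :: d :: p) := fun h => (reduced_cons_cons.1 h).1.2 (by simp)

lemma not_reduced_append_rev {d : E × Bool} {p : List (E × Bool)} :
    ¬ Γ.Reduced (p ++ [d] ++ [rev d]) := fun h => by
  rw [List.append_assoc] at h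
  exact (reduced_cons_cons.1 h.right).1.2 rfl

/-- `Q` is the middle part of a reduced path from `d` to `d'`, and it is shorter than `c`. -/
def IsMid (Γ : MetricGraph V E) (c : ℝ) (d d' : E × Bool) (Q : List (E × Bool)) : Prop :=
  Γ.Reduced (d :: Q ++ [d']) ∧ Γ.pathLength Q < c

lemma IsMid.reduced {c : ℝ} {d d' : E × Bool} {Q : List (E × Bool)} (h : Γ.IsMid c d d' Q) :
    Γ.Reduced Q := h.1.left.tail

lemma IsMid.isEdgePath {c : ℝ} {d d' : E × Bool} {Q : List (E × Bool)} (h : Γ.IsMid c d d' Q) :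
    Γ.IsEdgePath (Γ.terminus d) Q (Γ.origin d') := h.1.isEdgePath_mid

lemma IsMid.unique {c : ℝ} (hg : Γ.GirthAtLeast (2 * c)) {d d' : E × Bool}
    {Q Q' : List (E × Bool)} (h : Γ.IsMid c d d' Q) (h' : Γ.IsMid c d d' Q') : Q = Q' := by
  by_contra hne
  have := hg.le_add h.reduced h'.reduced h.isEdgePath h'.isEdgePath hne
  linarith [h.2, h'.2]

open Classical in
/-- The size of the corner triangle of the pair of edges `d`, `d'` consisting of the pairs of points
that are joined through the terminus of `d` and the origin of `d'` by a path shorter than `c`. -/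
noncomputable def cornerSize (Γ : MetricGraph V E) (c : ℝ) (d d' : E × Bool) : ℝ :=
  if h : ∃ Q, Γ.IsMid c d d' Q then c - Γ.pathLength h.choose else 0

lemma cornerSize_nonneg (c : ℝ) (d d' : E × Bool) : 0 ≤ Γ.cornerSize c d d' := by
  unfold cornerSize
  split_ifs with h
  · linarith [h.choose_spec.2]
  · rfl

lemma cornerSize_eq {c : ℝ} (hg : Γ.GirthAtLeast (2 * c)) {d d' : E × Bool}
    {Q : List (E × Bool)} (h : Γ.IsMid c d d' Q) : Γ.cornerSize c d d' = c - Γ.pathLength Q := by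
  have h' : ∃ Q, Γ.IsMid c d d' Q := ⟨Q, h⟩
  rw [cornerSize, dif_pos h', h.unique hg h'.choose_spec]

lemma exists_of_cornerSize_pos {c : ℝ} {d d' : E × Bool} (h : 0 < Γ.cornerSize c d d') :
    ∃ Q, Γ.IsMid c d d' Q ∧ Γ.cornerSize c d d' = c - Γ.pathLength Q := by
  unfold cornerSize at *
  split_ifs at * with h'
  · exact ⟨_, h'.choose_spec, rfl⟩
  · exact absurd h (lt_irrefl _)

/-- Non-overlap of adjacent triangles: `d :: Q` and `Q'` are different reduced paths with the same
endpoints, so their total length is at least 2c. The next two lemmas compare `Q'` with `Q ++ [d']`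
and `d :: Q ++ [d']` instead. -/
lemma cornerSize_add_rev_left {c : ℝ} (hg : Γ.GirthAtLeast (2 * c)) {d d' : E × Bool}
    (h : 0 < Γ.cornerSize c d d') (h' : 0 < Γ.cornerSize c (rev d) d') :
    Γ.cornerSize c d d' + Γ.cornerSize c (rev d) d' ≤ Γ.len d.1 := by
  obtain ⟨Q, hQ, e1⟩ := exists_of_cornerSize_pos h
  obtain ⟨Q', hQ', e2⟩ := exists_of_cornerSize_pos h'
  have h1 := hg.le_add (u := Γ.origin d) (p := d :: Q) hQ.1.left hQ'.reduced ⟨rfl, hQ.isEdgePath⟩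
    (by simpa using hQ'.isEdgePath) (by rintro rfl; exact not_reduced_rev_cons hQ'.1)
  rw [e1, e2]
  rw [pathLength_cons] at h1
  linarith

lemma cornerSize_add_rev_right {c : ℝ} (hg : Γ.GirthAtLeast (2 * c)) {d d' : E × Bool}
    (h : 0 < Γ.cornerSize c d d') (h' : 0 < Γ.cornerSize c d (rev d')) :
    Γ.cornerSize c d d' + Γ.cornerSize c d (rev d') ≤ Γ.len d'.1 := by
  obtain ⟨Q, hQ, e1⟩ := exists_of_cornerSize_pos h
  obtain ⟨Q', hQ', e2⟩ := exists_of_cornerSize_pos h'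
  have h1 := hg.le_add (u := Γ.terminus d) (v := Γ.terminus d') (p := Q ++ [d']) hQ.1.tail
    hQ'.reduced (isEdgePath_append.2 ⟨_, hQ.isEdgePath, rfl, rfl⟩)
    (by simpa using hQ'.isEdgePath) (by
      rintro rfl
      have := hQ'.1
      rw [← List.cons_append] at this
      exact not_reduced_append_rev this)
  rw [e1, e2]
  simp only [pathLength_append, pathLength_cons, pathLength_nil] at h1
  linarith

lemma cornerSize_add_rev_rev {c : ℝ} (hg : Γ.GirthAtLeast (2 * c)) {d d' : E × Bool}
    (h : 0 < Γ.cornerSize c d d') (h' : 0 < Γ.cornerSize c (rev d) (rev d')) :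
    Γ.cornerSize c d d' + Γ.cornerSize c (rev d) (rev d') ≤ Γ.len d.1 + Γ.len d'.1 := by
  obtain ⟨Q, hQ, e1⟩ := exists_of_cornerSize_pos h
  obtain ⟨Q', hQ', e2⟩ := exists_of_cornerSize_pos h'
  have h1 := hg.le_add (u := Γ.origin d) (v := Γ.terminus d') (p := d :: Q ++ [d']) hQ.1
    hQ'.reduced (isEdgePath_append.2 ⟨_, ⟨rfl, hQ.isEdgePath⟩, rfl, rfl⟩)
    (by simpa using hQ'.isEdgePath) (by rintro rfl; exact not_reduced_rev_cons hQ'.1)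
  rw [e1, e2]
  simp only [pathLength_append, pathLength_cons, pathLength_nil] at h1
  linarith

/-- A middle path from `d` to `rev d` would be a nonempty closed reduced path shorter than c. -/
lemma cornerSize_rev_self {c : ℝ} (hg : Γ.GirthAtLeast (2 * c)) (d : E × Bool) :
    Γ.cornerSize c d (rev d) = 0 := by
  refine le_antisymm (not_lt.1 fun h => ?_) (cornerSize_nonneg _ _ _)
  obtain ⟨Q, hQ, e1⟩ := exists_of_cornerSize_pos h
  have hne : Q ≠ [] := by
    rintro rfl
    exact (reduced_cons_cons.1 hQ.1).1.2 rfl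
  have := hg.le_of_closed hne hQ.reduced (v := Γ.terminus d) (by simpa using hQ.isEdgePath)
  have := Γ.pathLength_nonneg Q
  linarith [hQ.2]

lemma cornerSize_self_le {c : ℝ} (hg : Γ.GirthAtLeast (2 * c)) {d : E × Bool}
    (h : 0 < Γ.cornerSize c d d) : Γ.cornerSize c d d ≤ Γ.len d.1 - c := by
  obtain ⟨Q, hQ, e1⟩ := exists_of_cornerSize_pos h
  have := hg.le_of_closed (v := Γ.origin d) (p := d :: Q) (by simp) hQ.1.left ⟨rfl, hQ.isEdgePath⟩
  rw [pathLength_cons] at this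
  linarith

lemma pos_rev_eq_fromEnd (e : E) (i : Bool) (s : ℝ) :
    Γ.pos (rev (e, i)) s = fromEnd (Γ.len e) s i := by
  cases i <;> simp [pos, rev, fromEnd]

lemma pos_eq_fromEnd (e : E) (i : Bool) (s : ℝ) :
    Γ.pos (e, i) s = fromEnd (Γ.len e) s (!i) := by
  cases i <;> simp [pos, fromEnd]

lemma Joined.exists_cornerSize {c : ℝ} (hg : Γ.GirthAtLeast (2 * c)) {e e' : E} {s t : ℝ}
    (hs : s ∈ Set.Ioo 0 (Γ.len e)) (ht : t ∈ Set.Ioo 0 (Γ.len e')) (h : Γ.Joined e s e' t c) :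
    (e = e' ∧ |s - t| ≤ c) ∨ ∃ i j, fromEnd (Γ.len e) s i + fromEnd (Γ.len e') t (!j) ≤
      Γ.cornerSize c (e, i) (e', j) := by
  rcases h.exists_reduced hs ht with h | ⟨⟨e, i⟩, ⟨e', j⟩, Q, rfl, rfl, hred, hle⟩
  · exact Or.inl h
  refine Or.inr ⟨i, j, ?_⟩
  have h1 := (pos_mem (rev (e, i)) hs).1
  have h2 := (pos_mem (e', j) ht).1
  rw [cornerSize_eq hg ⟨hred, by linarith⟩, ← pos_rev_eq_fromEnd, ← pos_eq_fromEnd]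
  linarith

lemma sum_cornerArea_cornerSize (f : ℝ →+ ℝ) {c : ℝ} (hg : Γ.GirthAtLeast (2 * c)) {e e' : E}
    (hne : e ≠ e')
    (hj : ∀ s ∈ Set.Ioo 0 (Γ.len e), ∀ t ∈ Set.Ioo 0 (Γ.len e'), Γ.Joined e s e' t c) :
    ∑ i, ∑ j, cornerArea f (Γ.len e) (Γ.len e') (Γ.cornerSize c (e, i) (e', j)) =
      2 * f (Γ.len e) * f (Γ.len e') := by
  refine sum_cornerArea f (Γ.len_pos e) (Γ.len_pos e') _ (fun _ _ => cornerSize_nonneg _ _ _)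
    (fun i j => cornerSize_add_rev_left hg) (fun i j => cornerSize_add_rev_right hg)
    (fun i j => cornerSize_add_rev_rev hg) fun s hs t ht => ?_
  exact ((hj s hs t ht).exists_cornerSize hg hs ht).resolve_left fun h => hne h.1

/-- On an edge longer than c, points farther apart than c along the edge must be joined around a
closed path. This forces the triangles at the corners off the diagonal to reach exactly to the strip
|s - t| ≤ c. -/
lemma cornerSize_self_eq {c : ℝ} (hc : 0 < c) (hg : Γ.GirthAtLeast (2 * c)) {e : E}
    (hj : ∀ s ∈ Set.Ioo 0 (Γ.len e), ∀ t ∈ Set.Ioo 0 (Γ.len e), Γ.Joined e s e t c)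
    (hlt : c < Γ.len e) (i : Bool) : Γ.cornerSize c (e, i) (e, i) = Γ.len e - c := by
  have hle : ∀ i, Γ.cornerSize c (e, i) (e, i) ≤ Γ.len e - c := fun i => by
    by_cases h : 0 < Γ.cornerSize c (e, i) (e, i)
    · exact cornerSize_self_le hg h
    · linarith
  refine le_antisymm (hle i) ?_
  -- Test pairs at distance w > c, placed symmetrically in the edge: the other corners are too small
  -- to contain them. Letting w decrease to c gives the lower bound.
  have key : ∀ w ∈ Set.Ioo c (Γ.len e), Γ.len e - w ≤ Γ.cornerSize c (e, i) (e, i) := by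
    rintro w ⟨hw1, hw2⟩
    obtain ⟨s, hs, t, ht, h1, h2, h3⟩ : ∃ s ∈ Set.Ioo 0 (Γ.len e), ∃ t ∈ Set.Ioo 0 (Γ.len e),
        |s - t| = w ∧ fromEnd (Γ.len e) s i + fromEnd (Γ.len e) t (!i) = Γ.len e - w ∧
        fromEnd (Γ.len e) s (!i) + fromEnd (Γ.len e) t i = Γ.len e + w := by
      have hm : (Γ.len e + w) / 2 ∈ Set.Ioo 0 (Γ.len e) := ⟨by linarith, by linarith⟩
      have hm' : (Γ.len e - w) / 2 ∈ Set.Ioo 0 (Γ.len e) := ⟨by linarith, by linarith⟩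
      cases i
      · refine ⟨_, hm', _, hm, ?_, ?_, ?_⟩
        · rw [abs_sub_comm, abs_of_nonneg] <;> linarith
        · simp [fromEnd]; linarith
        · simp [fromEnd]; linarith
      · refine ⟨_, hm, _, hm', ?_, ?_, ?_⟩
        · rw [abs_of_nonneg] <;> linarith
        · simp [fromEnd]; linarith
        · simp [fromEnd]; linarith
    rcases (hj s hs t ht).exists_cornerSize hg hs ht with ⟨-, h⟩ | ⟨k, l, h⟩
    · linarith
    have h5 : ∀ x ∈ Set.Ioo 0 (Γ.len e), ∀ k, 0 < fromEnd (Γ.len e) x k := by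
      rintro x ⟨hx, hx'⟩ k
      cases k <;> simp [fromEnd] <;> linarith
    by_cases hkl : l = !k
    · subst hkl
      have := cornerSize_rev_self hg (e, k)
      rw [rev] at this
      simp only at this
      rw [this] at h
      linarith [h5 s hs k, h5 t ht (!!k)]
    · obtain rfl : l = k := by cases l <;> cases k <;> simp_all
      by_cases hki : l = i
      · subst hki; linarith
      · obtain rfl : l = !i := by cases l <;> cases i <;> simp_all
        have := hle (!i)
        rw [Bool.not_not] at h
        linarith
  refine le_of_forall_pos_le_add fun ε hε => ?_
  have := key (min (c + ε) ((c + Γ.len e) / 2)) ⟨lt_min (by linarith) (by linarith),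
    (min_le_right _ _).trans_lt (by linarith)⟩
  have := min_le_left (c + ε) ((c + Γ.len e) / 2)
  linarith

/-- The subtracted term is twice the f-area of the strip |s - t| ≤ c in the square. The cut-off
square makes one formula serve both when the strip is proper and when it is the whole square. -/
lemma sum_cornerArea_cornerSize_self (f : ℝ →+ ℝ) {c : ℝ} (hc : 0 < c)
    (hg : Γ.GirthAtLeast (2 * c)) {e : E}
    (hj : ∀ s ∈ Set.Ioo 0 (Γ.len e), ∀ t ∈ Set.Ioo 0 (Γ.len e), Γ.Joined e s e t c) :
    ∑ i, ∑ j, cornerArea f (Γ.len e) (Γ.len e) (Γ.cornerSize c (e, i) (e, j)) =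
      2 * f (Γ.len e) * f (Γ.len e) -
        2 * (2 * f c * f (Γ.len e) - f c ^ 2 + cutSq f (c - Γ.len e)) := by
  have ha := Γ.len_pos e
  have h1 := cornerSize_rev_self hg (e, true)
  have h2 := cornerSize_rev_self hg (e, false)
  simp only [rev, Bool.not_true, Bool.not_false] at h1 h2
  simp only [Fintype.sum_bool, h1, h2, cornerArea_zero f ha ha]
  rcases lt_or_ge c (Γ.len e) with hlt | hle
  · rw [cornerSize_self_eq hc hg hj hlt, cornerSize_self_eq hc hg hj hlt]
    unfold cornerArea
    rw [cutSq_of_pos f (r := Γ.len e - c) (by linarith),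
      cutSq_of_nonpos f (r := Γ.len e - c - Γ.len e) (by linarith),
      cutSq_of_nonpos f (r := Γ.len e - c - Γ.len e - Γ.len e) (by linarith),
      cutSq_of_nonpos f (r := c - Γ.len e) (by linarith), map_sub]
    ring
  · have h0 : ∀ i, Γ.cornerSize c (e, i) (e, i) = 0 := fun i =>
      le_antisymm (not_lt.1 fun h => by
        have := cornerSize_self_le hg h
        simp only at this
        linarith) (cornerSize_nonneg _ _ _)
    rw [h0, h0, cornerArea_zero f ha ha, cutSq_of_nonneg f (r := c - Γ.len e) (by linarith),
      map_sub]
    ring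

end MetricGraph

/-! ### Reindexing sums over lists prolonged at one end -/

/-- The list is nonempty and its first entry lies in `O`. -/
def HeadIn {α : Type*} (O : Finset α) (L : List α) : Prop := ∃ d ∈ L.head?, d ∈ O

/-- The list is nonempty and its last entry lies in `O`. -/
def LastIn {α : Type*} (O : Finset α) (L : List α) : Prop := ∃ d ∈ L.getLast?, d ∈ O

lemma headIn_cons {α : Type*} {O : Finset α} {d : α} {L : List α} :
    HeadIn O (d :: L) ↔ d ∈ O := by simp [HeadIn]

lemma lastIn_concat {α : Type*} {O : Finset α} {d : α} {L : List α} :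
    LastIn O (L ++ [d]) ↔ d ∈ O := by simp [LastIn]

lemma lastIn_cons_concat {α : Type*} {O : Finset α} {d d' : α} {L : List α} :
    LastIn O (d :: L ++ [d']) ↔ d' ∈ O := lastIn_concat

lemma LastIn.cons {α : Type*} {O : Finset α} {d : α} {L : List α} (h : LastIn O L) :
    LastIn O (d :: L) := by
  obtain ⟨x, hx, hx'⟩ := h
  obtain ⟨Q, rfl⟩ := List.getLast?_eq_some_iff.1 hx
  exact lastIn_cons_concat.2 hx'

open Classical in
lemma Finset.sum_cons_lists {α : Type*} (O : Finset α) (M : Finset (List α)) (G : List α → ℝ)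
    (hG : ∀ d ∈ O, ∀ Q, G (d :: Q) ≠ 0 → Q ∈ M ∧ d :: Q ∈ M) :
    ∑ d ∈ O, ∑ Q ∈ M, G (d :: Q) = ∑ L ∈ M, if HeadIn O L then G L else 0 := by
  rw [← Finset.sum_product' (f := fun d Q => G (d :: Q))]
  refine Finset.sum_bij_ne_zero (fun x _ _ => x.1 :: x.2) ?_ ?_ ?_ ?_
  · rintro ⟨d, Q⟩ h hne
    exact (hG d (Finset.mem_product.1 h).1 Q hne).2
  · rintro ⟨d, Q⟩ _ _ ⟨d', Q'⟩ _ _ h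
    simpa using h
  · rintro L hL hne
    have hc : HeadIn O L := by
      by_contra hc
      exact hne (if_neg hc)
    rw [if_pos hc] at hne
    obtain ⟨d, hd, hdO⟩ := hc
    obtain ⟨Q, rfl⟩ := List.head?_eq_some_iff.1 hd
    exact ⟨(d, Q), Finset.mem_product.2 ⟨hdO, (hG d hdO Q hne).1⟩, hne, rfl⟩
  · rintro ⟨d, Q⟩ h hne
    rw [if_pos (headIn_cons.2 (Finset.mem_product.1 h).1)]

open Classical in
lemma Finset.sum_concat_lists {α : Type*} (O : Finset α) (M : Finset (List α)) (G : List α → ℝ)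
    (hG : ∀ d ∈ O, ∀ Q, G (Q ++ [d]) ≠ 0 → Q ∈ M ∧ Q ++ [d] ∈ M) :
    ∑ d ∈ O, ∑ Q ∈ M, G (Q ++ [d]) = ∑ L ∈ M, if LastIn O L then G L else 0 := by
  rw [← Finset.sum_product' (f := fun d Q => G (Q ++ [d]))]
  refine Finset.sum_bij_ne_zero (fun x _ _ => x.2 ++ [x.1]) ?_ ?_ ?_ ?_
  · rintro ⟨d, Q⟩ h hne
    exact (hG d (Finset.mem_product.1 h).1 Q hne).2
  · rintro ⟨d, Q⟩ _ _ ⟨d', Q'⟩ _ _ h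
    simp only [List.append_eq_append_iff_of_size_eq_right, List.length_singleton] at h
    simp_all
  · rintro L hL hne
    have hc : LastIn O L := by
      by_contra hc
      exact hne (if_neg hc)
    rw [if_pos hc] at hne
    obtain ⟨d, hd, hdO⟩ := hc
    obtain ⟨Q, rfl⟩ := List.getLast?_eq_some_iff.1 hd
    exact ⟨(d, Q), Finset.mem_product.2 ⟨hdO, (hG d hdO Q hne).1⟩, hne, rfl⟩
  · rintro ⟨d, Q⟩ h hne
    rw [if_pos (lastIn_concat.2 (Finset.mem_product.1 h).1)]

/-! ### Double counting of paths between edges of a leafless set -/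

namespace MetricGraph

variable {V E : Type*} {Γ : MetricGraph V E}

/-- Every oriented edge over `S` is preceded by one over `S` without backtracking, that is, all
degrees in the subgraph spanned by `S` are at least two. -/
def NoLeaves (Γ : MetricGraph V E) (S : Finset E) : Prop :=
  ∀ d : E × Bool, d.1 ∈ S → ∃ d₀ : E × Bool, d₀.1 ∈ S ∧ Γ.Next d₀ d

lemma NoLeaves.exists_next {S : Finset E} (hS : Γ.NoLeaves S) {d : E × Bool} (hd : d.1 ∈ S) :
    ∃ d₁ : E × Bool, d₁.1 ∈ S ∧ Γ.Next d d₁ := by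
  obtain ⟨d₀, h, hn⟩ := hS (rev d) hd
  exact ⟨rev d₀, h, by simpa using hn.rev⟩

/-- The oriented edges over `S`. -/
def oriented (S : Finset E) : Finset (E × Bool) := S ×ˢ Finset.univ

@[simp] lemma mem_oriented {S : Finset E} {d : E × Bool} : d ∈ oriented S ↔ d.1 ∈ S := by
  simp [oriented]

/-- The middle parts shorter than `c` of the reduced paths between edges of `S`. -/
def mids (Γ : MetricGraph V E) (c : ℝ) (S : Finset E) : Set (List (E × Bool)) :=
  {Q | ∃ d d' : E × Bool, d.1 ∈ S ∧ d'.1 ∈ S ∧ Γ.IsMid c d d' Q}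

/-- By the girth there is at most one middle path for each pair of oriented edges, although Γ itself
may be infinite. -/
lemma finite_mids {c : ℝ} (hg : Γ.GirthAtLeast (2 * c)) (S : Finset E) : (Γ.mids c S).Finite := by
  have : Γ.mids c S = ⋃ x ∈ (oriented S ×ˢ oriented S), {Q | Γ.IsMid c x.1 x.2 Q} := by
    ext Q
    simp only [mids, Set.mem_ofPred_eq, Set.mem_iUnion, Finset.mem_product, mem_oriented]
    exact ⟨fun ⟨d, d', h1, h2, h3⟩ => ⟨(d, d'), ⟨h1, h2⟩, h3⟩,
      fun ⟨⟨d, d'⟩, ⟨h1, h2⟩, h3⟩ => ⟨d, d', h1, h2, h3⟩⟩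
  rw [this]
  refine Set.Finite.biUnion (Finset.finite_toSet _) fun x _ => ?_
  exact Set.Subsingleton.finite fun Q hQ Q' hQ' => IsMid.unique hg hQ hQ'

open Classical in
lemma sum_mids {c : ℝ} (hg : Γ.GirthAtLeast (2 * c)) {S : Finset E} (f : ℝ →+ ℝ)
    {M : Finset (List (E × Bool))} (hM : ∀ Q, Q ∈ M ↔ Q ∈ Γ.mids c S)
    {d d' : E × Bool} (hd : d.1 ∈ S) (hd' : d'.1 ∈ S) :
    ∑ Q ∈ M, (if Γ.Reduced (d :: Q ++ [d']) then
      cornerArea f (Γ.len d.1) (Γ.len d'.1) (c - Γ.pathLength Q) else 0) =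
      cornerArea f (Γ.len d.1) (Γ.len d'.1) (Γ.cornerSize c d d') := by
  have hlt : ∀ Q ∈ M, Γ.pathLength Q < c := fun Q hQ => by
    obtain ⟨_, _, _, _, h⟩ := (hM Q).1 hQ
    exact h.2
  by_cases h : ∃ Q, Γ.IsMid c d d' Q
  · obtain ⟨Q, hQ⟩ := h
    rw [Finset.sum_eq_single Q, if_pos hQ.1, cornerSize_eq hg hQ]
    · intro Q' hQ' hne
      exact if_neg fun hred => hne (IsMid.unique hg ⟨hred, hlt Q' hQ'⟩ hQ)
    · intro hQ'
      exact absurd ((hM Q).2 ⟨d, d', hd, hd', hQ⟩) hQ'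
  · rw [cornerSize, dif_neg h, cornerArea_zero f (Γ.len_pos _) (Γ.len_pos _)]
    exact Finset.sum_eq_zero fun Q hQ => if_neg fun hred => h ⟨Q, hred, hlt Q hQ⟩

lemma reduced_cons_append_iff {d d' : E × Bool} {L : List (E × Bool)} (hL : L ≠ []) :
    Γ.Reduced (d :: L ++ [d']) ↔ Γ.Reduced (d :: L) ∧ Γ.Reduced (L ++ [d']) := by
  refine ⟨fun h => ⟨h.left, h.tail⟩, fun h => ?_⟩
  obtain ⟨x, L, rfl⟩ := List.exists_cons_of_ne_nil hL
  exact reduced_cons_cons.2 ⟨(reduced_cons_cons.1 h.1).1, h.2⟩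

lemma NoLeaves.exists_reduced_cons {S : Finset E} (hS : Γ.NoLeaves S) {L : List (E × Bool)}
    (hL : Γ.Reduced L) (h : HeadIn (oriented S) L) :
    ∃ d ∈ oriented S, Γ.Reduced (d :: L) := by
  obtain ⟨x, hx, hxS⟩ := h
  obtain ⟨Q, rfl⟩ := List.head?_eq_some_iff.1 hx
  obtain ⟨d, hd, hn⟩ := hS x (by simpa using hxS)
  exact ⟨d, by simpa using hd, reduced_cons_cons.2 ⟨hn, hL⟩⟩

lemma NoLeaves.exists_reduced_concat {S : Finset E} (hS : Γ.NoLeaves S) {L : List (E × Bool)}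
    (hL : Γ.Reduced L) (h : LastIn (oriented S) L) :
    ∃ d ∈ oriented S, Γ.Reduced (L ++ [d]) := by
  obtain ⟨x, hx, hxS⟩ := h
  obtain ⟨Q, rfl⟩ := List.getLast?_eq_some_iff.1 hx
  obtain ⟨d, hd, hn⟩ := hS.exists_next (d := x) (by simpa using hxS)
  refine ⟨d, by simpa using hd, ?_⟩
  rw [List.append_assoc]
  exact hL.glue (by simpa [Reduced] using hn)

open Classical in
/-- The number of oriented edges over `S` by which a path can be prolonged at its origin. -/
noncomputable def preCount (Γ : MetricGraph V E) (S : Finset E) (L : List (E × Bool)) : ℝ :=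
  ∑ d ∈ oriented S, if Γ.Reduced (d :: L) then 1 else 0

open Classical in
/-- The number of oriented edges over `S` by which a path can be prolonged at its terminus. -/
noncomputable def postCount (Γ : MetricGraph V E) (S : Finset E) (L : List (E × Bool)) : ℝ :=
  ∑ d ∈ oriented S, if Γ.Reduced (L ++ [d]) then 1 else 0

open Classical in
lemma NoLeaves.le_preCount {S : Finset E} (hS : Γ.NoLeaves S) {L : List (E × Bool)}
    (hL : Γ.Reduced L) : (if HeadIn (oriented S) L then 1 else 0) ≤ Γ.preCount S L := by
  have hnn : ∀ d ∈ oriented S, (0 : ℝ) ≤ if Γ.Reduced (d :: L) then 1 else 0 :=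
    fun d _ => by split_ifs <;> norm_num
  split_ifs with h
  · obtain ⟨d, hd, hr⟩ := hS.exists_reduced_cons hL h
    refine le_trans ?_ (Finset.single_le_sum hnn hd)
    rw [if_pos hr]
  · exact Finset.sum_nonneg hnn

open Classical in
lemma NoLeaves.le_postCount {S : Finset E} (hS : Γ.NoLeaves S) {L : List (E × Bool)}
    (hL : Γ.Reduced L) : (if LastIn (oriented S) L then 1 else 0) ≤ Γ.postCount S L := by
  have hnn : ∀ d ∈ oriented S, (0 : ℝ) ≤ if Γ.Reduced (L ++ [d]) then 1 else 0 :=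
    fun d _ => by split_ifs <;> norm_num
  split_ifs with h
  · obtain ⟨d, hd, hr⟩ := hS.exists_reduced_concat hL h
    refine le_trans ?_ (Finset.single_le_sum hnn hd)
    rw [if_pos hr]
  · exact Finset.sum_nonneg hnn

-- Regrouping by the path at which `th` is evaluated: `L` may arise as Q, dQ, Qd' or dQd'.
-- Leaflessness ensures that every such `L` with nonzero weight is again a middle path, because it
-- can be prolonged over S at the ends.
open Classical in
lemma NoLeaves.sum_ends {c : ℝ} {S : Finset E} (hS : Γ.NoLeaves S) {th : List (E × Bool) → ℝ}
    (hth : ∀ L, c ≤ Γ.pathLength L → th L = 0)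
    {M : Finset (List (E × Bool))} (hM : ∀ Q, Q ∈ M ↔ Q ∈ Γ.mids c S) :
    ∑ d ∈ oriented S, ∑ d' ∈ oriented S, ∑ Q ∈ M, (if Γ.Reduced (d :: Q ++ [d']) then
      (th Q - th (d :: Q) - th (Q ++ [d']) + th (d :: Q ++ [d'])) else 0) =
    ∑ L ∈ M, ((∑ d ∈ oriented S, ∑ d' ∈ oriented S,
        if Γ.Reduced (d :: L ++ [d']) then 1 else 0)
      - (if HeadIn (oriented S) L then 1 else 0) * Γ.postCount S L
      - Γ.preCount S L * (if LastIn (oriented S) L then 1 else 0)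
      + (if HeadIn (oriented S) L then 1 else 0) *
        (if LastIn (oriented S) L.tail then 1 else 0)) * th L := by
  have hshort : ∀ {L Q : List (E × Bool)}, th L ≠ 0 → Γ.pathLength Q ≤ Γ.pathLength L →
      Γ.pathLength Q < c := by
    intro L Q hL hQ
    by_contra hc
    exact hL (hth L ((not_lt.1 hc).trans hQ))
  have hmid : ∀ {d d' Q}, d ∈ oriented S → d' ∈ oriented S → Γ.Reduced (d :: Q ++ [d']) →
      Γ.pathLength Q < c → Q ∈ M := fun hd hd' hr hl =>
    (hM _).2 ⟨_, _, by simpa using hd, by simpa using hd', hr, hl⟩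
  have hpre : ∀ {d d' Q}, d ∈ oriented S → d' ∈ oriented S → Γ.Reduced (d :: Q ++ [d']) →
      th (d :: Q) ≠ 0 → d :: Q ∈ M := by
    intro d d' Q hd hd' hr ht
    obtain ⟨d₀, hd₀, hr₀⟩ := hS.exists_reduced_cons hr (headIn_cons.2 hd)
    exact hmid hd₀ hd' hr₀ (hshort ht le_rfl)
  have hpost : ∀ {d d' Q}, d ∈ oriented S → d' ∈ oriented S → Γ.Reduced (d :: Q ++ [d']) →
      th (Q ++ [d']) ≠ 0 → Q ++ [d'] ∈ M := by
    intro d d' Q hd hd' hr ht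
    obtain ⟨d₀, hd₀, hr₀⟩ := hS.exists_reduced_concat hr (lastIn_cons_concat.2 hd')
    exact hmid hd hd₀ hr₀ (hshort ht le_rfl)
  have hA : ∀ (d : E × Bool) Q, Γ.pathLength Q ≤ Γ.pathLength (d :: Q) := fun d Q => by
    have := Γ.len_pos d.1; simp; linarith
  have hB : ∀ (d : E × Bool) Q, Γ.pathLength Q ≤ Γ.pathLength (Q ++ [d]) := fun d Q => by
    have := Γ.len_pos d.1; simp; linarith
  have T1 : ∑ d ∈ oriented S, ∑ d' ∈ oriented S, ∑ Q ∈ M,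
      (if Γ.Reduced (d :: Q ++ [d']) then th Q else 0) =
      ∑ L ∈ M, (∑ d ∈ oriented S, ∑ d' ∈ oriented S,
        if Γ.Reduced (d :: L ++ [d']) then 1 else 0) * th L := by
    simp_rw [Finset.sum_comm (s := oriented S) (t := M), Finset.sum_mul]
    simp
  have T2 : ∑ d ∈ oriented S, ∑ d' ∈ oriented S, ∑ Q ∈ M,
      (if Γ.Reduced (d :: Q ++ [d']) then th (d :: Q) else 0) =
      ∑ L ∈ M, (if HeadIn (oriented S) L then 1 else 0) * Γ.postCount S L * th L := by
    rw [Finset.sum_comm]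
    have : ∀ d' ∈ oriented S, ∑ d ∈ oriented S, ∑ Q ∈ M,
        (if Γ.Reduced (d :: Q ++ [d']) then th (d :: Q) else 0) =
        ∑ L ∈ M, if HeadIn (oriented S) L then
          (if Γ.Reduced (L ++ [d']) then th L else 0) else 0 := by
      intro d' hd'
      refine Finset.sum_cons_lists (oriented S) M
        (fun L => if Γ.Reduced (L ++ [d']) then th L else 0) fun d hd Q h => ?_
      have hr : Γ.Reduced (d :: Q ++ [d']) := by
        by_contra hc; exact h (if_neg hc)
      rw [if_pos hr] at h
      exact ⟨hmid hd hd' hr (hshort h (hA d Q)), hpre hd hd' hr h⟩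
    rw [Finset.sum_congr rfl this, Finset.sum_comm]
    refine Finset.sum_congr rfl fun L _ => ?_
    simp only [postCount]
    split_ifs with h
    · rw [one_mul, Finset.sum_mul]; simp
    · simp
  have T3 : ∑ d ∈ oriented S, ∑ d' ∈ oriented S, ∑ Q ∈ M,
      (if Γ.Reduced (d :: Q ++ [d']) then th (Q ++ [d']) else 0) =
      ∑ L ∈ M, Γ.preCount S L * (if LastIn (oriented S) L then 1 else 0) * th L := by
    have : ∀ d ∈ oriented S, ∑ d' ∈ oriented S, ∑ Q ∈ M,
        (if Γ.Reduced (d :: Q ++ [d']) then th (Q ++ [d']) else 0) =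
        ∑ L ∈ M, if LastIn (oriented S) L then
          (if Γ.Reduced (d :: L) then th L else 0) else 0 := by
      intro d hd
      refine Finset.sum_concat_lists (oriented S) M
        (fun L => if Γ.Reduced (d :: L) then th L else 0) fun d' hd' Q h => ?_
      have hr : Γ.Reduced (d :: Q ++ [d']) := by
        by_contra hc; exact h (if_neg hc)
      rw [← List.cons_append, if_pos hr] at h
      exact ⟨hmid hd hd' hr (hshort h (hB d' Q)), hpost hd hd' hr h⟩
    rw [Finset.sum_congr rfl this, Finset.sum_comm]
    refine Finset.sum_congr rfl fun L _ => ?_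
    simp only [preCount]
    split_ifs with h
    · rw [mul_one, Finset.sum_mul]; simp
    · simp
  -- A path of the form dQd' has at least two edges, so its last edge is sought in the tail: a
  -- single edge over S contributes nothing here.
  have T4 : ∑ d ∈ oriented S, ∑ d' ∈ oriented S, ∑ Q ∈ M,
      (if Γ.Reduced (d :: Q ++ [d']) then th (d :: Q ++ [d']) else 0) =
      ∑ L ∈ M, (if HeadIn (oriented S) L then 1 else 0) *
        (if LastIn (oriented S) L.tail then 1 else 0) * th L := by
    have : ∀ d ∈ oriented S, ∑ d' ∈ oriented S, ∑ Q ∈ M,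
        (if Γ.Reduced (d :: Q ++ [d']) then th (d :: Q ++ [d']) else 0) =
        ∑ L ∈ M, if LastIn (oriented S) L then
          (if Γ.Reduced (d :: L) then th (d :: L) else 0) else 0 := by
      intro d hd
      refine Finset.sum_concat_lists (oriented S) M
        (fun L => if Γ.Reduced (d :: L) then th (d :: L) else 0) fun d' hd' Q h => ?_
      have hr : Γ.Reduced (d :: Q ++ [d']) := by
        by_contra hc; exact h (if_neg hc)
      rw [← List.cons_append, if_pos hr] at h
      refine ⟨hmid hd hd' hr (hshort h ((hA d Q).trans (hB d' _))), ?_⟩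
      obtain ⟨d₀, hd₀, hr₀⟩ := hS.exists_reduced_concat hr (lastIn_cons_concat.2 hd')
      exact hmid hd hd₀ hr₀ (hshort h (hA d _))
    rw [Finset.sum_congr rfl this]
    have h2 : ∑ d ∈ oriented S, ∑ L ∈ M, (if LastIn (oriented S) L then
          (if Γ.Reduced (d :: L) then th (d :: L) else 0) else 0) = _ :=
      Finset.sum_cons_lists (oriented S) M
      (fun L => if LastIn (oriented S) L.tail then
        (if Γ.Reduced L then th L else 0) else 0) (by
      intro d hd Q h
      change (if LastIn (oriented S) Q then
        (if Γ.Reduced (d :: Q) then th (d :: Q) else 0) else 0) ≠ 0 at h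
      have hl : LastIn (oriented S) Q := by
        by_contra hc; exact h (if_neg hc)
      rw [if_pos hl] at h
      have hr : Γ.Reduced (d :: Q) := by
        by_contra hc; exact h (if_neg hc)
      rw [if_pos hr] at h
      obtain ⟨d', hd', hr'⟩ := hS.exists_reduced_concat (L := d :: Q) hr hl.cons
      exact ⟨hmid hd hd' hr' (hshort h (hA d Q)), hpre hd hd' hr' h⟩)
    rw [h2]
    refine Finset.sum_congr rfl fun L hL => ?_
    obtain ⟨_, _, _, _, hmid⟩ := (hM L).1 hL
    rw [if_pos hmid.reduced]
    split_ifs <;> simp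
  have split : ∀ d d' Q, (if Γ.Reduced (d :: Q ++ [d']) then
      (th Q - th (d :: Q) - th (Q ++ [d']) + th (d :: Q ++ [d'])) else 0) =
      (if Γ.Reduced (d :: Q ++ [d']) then th Q else 0) -
      (if Γ.Reduced (d :: Q ++ [d']) then th (d :: Q) else 0) -
      (if Γ.Reduced (d :: Q ++ [d']) then th (Q ++ [d']) else 0) +
      (if Γ.Reduced (d :: Q ++ [d']) then th (d :: Q ++ [d']) else 0) := by
    intro d d' Q
    split_ifs <;> simp
  simp only [split, Finset.sum_add_distrib, Finset.sum_sub_distrib, T1, T2, T3, T4, add_mul,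
    sub_mul]

end MetricGraph

/-! ### The quadratic inequality and rationality of the total length -/

namespace MetricGraph

variable {V E : Type*} {Γ : MetricGraph V E}

open Classical in
lemma sum_reduced_eq_mul {S : Finset E} {L : List (E × Bool)} (hL : L ≠ []) :
    (∑ d ∈ oriented S, ∑ d' ∈ oriented S, if Γ.Reduced (d :: L ++ [d']) then (1 : ℝ) else 0) =
      Γ.preCount S L * Γ.postCount S L := by
  unfold preCount postCount
  rw [Finset.sum_mul_sum]
  refine Finset.sum_congr rfl fun d _ => Finset.sum_congr rfl fun d' _ => ?_
  simp only [reduced_cons_append_iff hL]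
  split_ifs <;> simp_all

open Classical in
lemma NoLeaves.card_le {S : Finset E} (hS : Γ.NoLeaves S) :
    ((oriented S).card : ℝ) ≤ ∑ d ∈ oriented S, ∑ d' ∈ oriented S,
      if Γ.Reduced (d :: [] ++ [d']) then (1 : ℝ) else 0 := by
  rw [Finset.card_eq_sum_ones, Nat.cast_sum]
  refine Finset.sum_le_sum fun d hd => ?_
  obtain ⟨d', hd', hn⟩ := hS.exists_next (by simpa using hd)
  refine le_trans ?_ (Finset.single_le_sum (f := fun d' => if Γ.Reduced (d :: [] ++ [d'])
    then (1 : ℝ) else 0) (fun d' _ => by split_ifs <;> norm_num)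
    (mem_oriented.2 hd'))
  have : Γ.Reduced (d :: [] ++ [d']) := by simpa [Reduced] using hn
  rw [if_pos this]
  simp

-- Let h and l be 1 or 0 according as the first and last edges of `L` lie over S. For at least two
-- edges the coefficient of `th L` is (pre - h)(post - l) ≥ 0. For one edge the term hl is missing,
-- which costs at most `th L`. The empty path counts composable pairs, at least one for each
-- oriented edge.
open Classical in
lemma NoLeaves.le_sum_ends {c : ℝ} (hc : 0 < c) {S : Finset E} (hS : Γ.NoLeaves S)
    {th : List (E × Bool) → ℝ} (hnn : ∀ L, 0 ≤ th L)
    (hth : ∀ L, c ≤ Γ.pathLength L → th L = 0)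
    {M : Finset (List (E × Bool))} (hM : ∀ Q, Q ∈ M ↔ Q ∈ Γ.mids c S) :
    (oriented S).card * th [] - ∑ d ∈ oriented S, th [d] ≤
    ∑ d ∈ oriented S, ∑ d' ∈ oriented S, ∑ Q ∈ M, (if Γ.Reduced (d :: Q ++ [d']) then
      (th Q - th (d :: Q) - th (Q ++ [d']) + th (d :: Q ++ [d'])) else 0) := by
  rw [hS.sum_ends hth hM]
  have hterm : ∀ L ∈ M, (if L = [] then (oriented S).card * th [] else 0) -
      (if L ∈ (oriented S).image (fun d => [d]) then th L else 0) ≤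
      ((∑ d ∈ oriented S, ∑ d' ∈ oriented S, if Γ.Reduced (d :: L ++ [d']) then 1 else 0)
      - (if HeadIn (oriented S) L then 1 else 0) * Γ.postCount S L
      - Γ.preCount S L * (if LastIn (oriented S) L then 1 else 0)
      + (if HeadIn (oriented S) L then 1 else 0) *
        (if LastIn (oriented S) L.tail then 1 else 0)) * th L := by
    intro L hLM
    obtain ⟨_, _, _, _, hmid⟩ := (hM L).1 hLM
    have hred := hmid.reduced
    have h1 := hS.le_preCount hred
    have h2 := hS.le_postCount hred
    rcases L with _ | ⟨x, L⟩
    · have hh : ¬ HeadIn (oriented S) [] := by simp [HeadIn]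
      have hl : ¬ LastIn (oriented S) [] := by simp [LastIn]
      have h3 : ([] : List (E × Bool)) ∉ (oriented S).image (fun d => [d]) := by simp
      have hcard := mul_le_mul_of_nonneg_right hS.card_le (hnn [])
      rw [if_neg h3, if_neg hh, if_neg hl, if_pos rfl]
      linarith
    · rw [sum_reduced_eq_mul (by simp), if_neg (by simp), List.tail_cons]
      have hx : HeadIn (oriented S) (x :: L) ↔ x ∈ oriented S := headIn_cons
      rcases L with _ | ⟨y, L⟩
      · have hl : ¬ LastIn (oriented S) [] := by simp [LastIn]
        have hx' : LastIn (oriented S) [x] ↔ x ∈ oriented S := lastIn_concat (L := [])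
        have hi : [x] ∈ (oriented S).image (fun d => [d]) ↔ x ∈ oriented S := by simp
        rw [if_neg hl]
        simp only [hx, hx', hi] at h1 h2 ⊢
        have hmul := mul_nonneg (mul_nonneg (sub_nonneg.2 h1) (sub_nonneg.2 h2)) (hnn [x])
        split_ifs at hmul ⊢ <;> linarith
      · have hl : LastIn (oriented S) (x :: y :: L) ↔ LastIn (oriented S) (y :: L) := by
          simp [LastIn]
        have hi : x :: y :: L ∉ (oriented S).image (fun d => [d]) := by simp
        rw [if_neg hi]
        simp only [hl] at h2 ⊢
        have hmul := mul_nonneg (mul_nonneg (sub_nonneg.2 h1) (sub_nonneg.2 h2))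
          (hnn (x :: y :: L))
        linarith
  refine le_trans ?_ (Finset.sum_le_sum hterm)
  rw [Finset.sum_sub_distrib]
  refine sub_le_sub ?_ ?_
  · rcases (oriented S).eq_empty_or_nonempty with h | ⟨d, hd⟩
    · simp [h]
    · have hmem : [] ∈ M := by
        obtain ⟨d', hd', hn⟩ := hS.exists_next (by simpa using hd)
        exact (hM _).2 ⟨d, d', by simpa using hd, hd', by simpa [Reduced] using hn, by simpa⟩
      rw [Finset.sum_ite_eq' M [], if_pos hmem]
  · rw [← Finset.sum_filter, Finset.filter_mem_eq_inter]
    calc ∑ L ∈ M ∩ (oriented S).image (fun d => [d]), th L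
        ≤ ∑ L ∈ (oriented S).image (fun d => [d]), th L :=
          Finset.sum_le_sum_of_subset_of_nonneg Finset.inter_subset_right fun L _ _ => hnn L
      _ = ∑ d ∈ oriented S, th [d] := Finset.sum_image fun _ _ _ _ h => by simpa using h

lemma sum_oriented {S : Finset E} (g : E × Bool → ℝ) :
    ∑ d ∈ oriented S, g d = ∑ e ∈ S, ∑ i, g (e, i) := by
  unfold oriented
  rw [Finset.sum_product]

/-- The key inequality for the total length of a finite subgraph without leaves and of
diameter at most `c` in a graph of girth at least `2 * c`. -/
lemma NoLeaves.two_mul_le_sq {c : ℝ} (hc : 0 < c) (hg : Γ.GirthAtLeast (2 * c)) {S : Finset E}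
    (hS : Γ.NoLeaves S)
    (hj : ∀ e ∈ S, ∀ e' ∈ S, ∀ s ∈ Set.Ioo 0 (Γ.len e), ∀ t ∈ Set.Ioo 0 (Γ.len e'),
      Γ.Joined e s e' t c) (f : ℝ →+ ℝ) :
    2 * f c * f (∑ e ∈ S, Γ.len e) ≤ f (∑ e ∈ S, Γ.len e) ^ 2 := by
  classical
  set M := (finite_mids hg S).toFinset with hMdef
  have hM : ∀ Q, Q ∈ M ↔ Q ∈ Γ.mids c S := fun Q => by simp [hMdef]
  set th : List (E × Bool) → ℝ := fun L => cutSq f (c - Γ.pathLength L) with hthdef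
  -- The weights are squares, hence nonnegative although f may take either sign; this is what lets
  -- the lower bound apply to arbitrary additive f.
  have hlow := hS.le_sum_ends hc (th := th) (fun L => cutSq_nonneg f _)
    (fun L hL => cutSq_of_nonpos f (by linarith)) hM
  have hsum : ∀ d ∈ oriented S, ∀ d' ∈ oriented S,
      ∑ Q ∈ M, (if Γ.Reduced (d :: Q ++ [d']) then
      (th Q - th (d :: Q) - th (Q ++ [d']) + th (d :: Q ++ [d'])) else 0) =
      cornerArea f (Γ.len d.1) (Γ.len d'.1) (Γ.cornerSize c d d') := by
    intro d hd d' hd'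
    rw [← sum_mids hg f hM (by simpa using hd) (by simpa using hd')]
    refine Finset.sum_congr rfl fun Q _ => if_congr Iff.rfl ?_ rfl
    simp only [hthdef, cornerArea, pathLength_append, pathLength_cons, pathLength_nil, add_zero]
    rw [sub_sub c _ (Γ.len d.1), sub_sub c _ (Γ.len d'.1), sub_sub c _ (Γ.len d'.1),
      add_comm (Γ.len d.1)]
  rw [Finset.sum_congr rfl fun d hd => Finset.sum_congr rfl (hsum d hd)] at hlow
  have htotal : ∑ d ∈ oriented S, ∑ d' ∈ oriented S,
      cornerArea f (Γ.len d.1) (Γ.len d'.1) (Γ.cornerSize c d d') =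
      ∑ e ∈ S, ∑ e' ∈ S, (2 * f (Γ.len e) * f (Γ.len e') - if e = e' then
        2 * (2 * f c * f (Γ.len e) - f c ^ 2 + cutSq f (c - Γ.len e)) else 0) := by
    simp only [sum_oriented]
    refine Finset.sum_congr rfl fun e he => ?_
    rw [Finset.sum_comm]
    refine Finset.sum_congr rfl fun e' he' => ?_
    split_ifs with h
    · subst h
      exact sum_cornerArea_cornerSize_self f hc hg (hj e he e he')
    · rw [sub_zero]
      exact sum_cornerArea_cornerSize f hg h (hj e he e' he')
  rw [htotal] at hlow
  have hcard : ((oriented S).card : ℝ) = 2 * S.card := by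
    simp [oriented]; ring
  have h0 : th [] = f c ^ 2 := by simp [hthdef, cutSq_of_pos f hc]
  have h1 : ∑ d ∈ oriented S, th [d] = 2 * ∑ e ∈ S, cutSq f (c - Γ.len e) := by
    rw [sum_oriented, Finset.mul_sum]
    refine Finset.sum_congr rfl fun e _ => ?_
    simp [hthdef]
  rw [hcard, h0, h1] at hlow
  have h2 : ∑ e ∈ S, ∑ e' ∈ S, (2 * f (Γ.len e) * f (Γ.len e') - if e = e' then
        2 * (2 * f c * f (Γ.len e) - f c ^ 2 + cutSq f (c - Γ.len e)) else 0) =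
      2 * f (∑ e ∈ S, Γ.len e) ^ 2 - 4 * f c * f (∑ e ∈ S, Γ.len e) + 2 * S.card * f c ^ 2
        - 2 * ∑ e ∈ S, cutSq f (c - Γ.len e) := by
    have h3 : ∑ e ∈ S, ∑ e' ∈ S, 2 * f (Γ.len e) * f (Γ.len e') =
        2 * f (∑ e ∈ S, Γ.len e) ^ 2 := by
      rw [map_sum, sq, Finset.sum_mul_sum, Finset.mul_sum]
      refine Finset.sum_congr rfl fun e _ => ?_
      rw [Finset.mul_sum]
      exact Finset.sum_congr rfl fun e' _ => by ring
    have h4 : ∑ e ∈ S, ∑ e' ∈ S, (if e = e' then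
        2 * (2 * f c * f (Γ.len e) - f c ^ 2 + cutSq f (c - Γ.len e)) else 0) =
        4 * f c * f (∑ e ∈ S, Γ.len e) - 2 * S.card * f c ^ 2
          + 2 * ∑ e ∈ S, cutSq f (c - Γ.len e) := by
      rw [map_sum, Finset.mul_sum, Finset.mul_sum]
      have h5 : (2 * S.card * f c ^ 2 : ℝ) = ∑ e ∈ S, 2 * f c ^ 2 := by simp; ring
      rw [h5, ← Finset.sum_sub_distrib, ← Finset.sum_add_distrib]
      refine Finset.sum_congr rfl fun e he => ?_
      rw [Finset.sum_ite_eq S e, if_pos he]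
      ring
    simp only [Finset.sum_sub_distrib] at h4 ⊢
    rw [h3, h4]
    ring
  rw [h2] at hlow
  linarith

/-- The total length is a rational multiple of the diameter bound. -/
lemma NoLeaves.exists_rat {c : ℝ} (hc : 0 < c) (hg : Γ.GirthAtLeast (2 * c)) {S : Finset E}
    (hS : Γ.NoLeaves S)
    (hj : ∀ e ∈ S, ∀ e' ∈ S, ∀ s ∈ Set.Ioo 0 (Γ.len e), ∀ t ∈ Set.Ioo 0 (Γ.len e'),
      Γ.Joined e s e' t c) : ∃ q : ℚ, ∑ e ∈ S, Γ.len e = q * c := by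
  by_contra hne
  have hmem : ∑ e ∈ S, Γ.len e ∉ Submodule.span ℚ {c} := fun h => by
    obtain ⟨q, hq⟩ := Submodule.mem_span_singleton.1 h
    exact hne ⟨q, by rw [← hq, Rat.smul_def]⟩
  -- A ℚ-linear functional killing c but not Λ allows x / c to be corrected to an additive map with
  -- value 1 at both c and Λ.
  obtain ⟨g, hg0, hgc⟩ := Submodule.exists_le_ker_of_notMem hmem
  set Λ := ∑ e ∈ S, Γ.len e with hΛ
  have hgc' : g c = 0 := hgc (Submodule.mem_span_singleton_self c)
  have hg0' : (g Λ : ℝ) ≠ 0 := by exact_mod_cast hg0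
  let f : ℝ →+ ℝ := AddMonoidHom.mk' (fun x => x / c + (1 - Λ / c) / (g Λ : ℝ) * (g x : ℝ))
    fun x y => by simp; ring
  have hfc : f c = 1 := by simp [f, hgc', hc.ne']
  have hfΛ : f Λ = 1 := by
    simp only [f, AddMonoidHom.mk'_apply]
    field_simp
    ring
  have := hS.two_mul_le_sq hc hg hj f
  rw [← hΛ, hfc, hfΛ] at this
  norm_num at this

end MetricGraph

/-! ### Leafless edge sets from cycles and segments -/

namespace MetricGraph

variable {V E : Type*} {Γ : MetricGraph V E}

lemma IsEdgePath.end_mem {u v : V} {p : List (E × Bool)} (h : Γ.IsEdgePath u p v) :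
    v ∈ u :: p.map Γ.terminus := by
  induction p generalizing u with
  | nil => simpa [IsEdgePath, eq_comm] using h
  | cons d p ih => simpa using Or.inr (by simpa using ih h.2)

lemma IsEdgePath.origin_mem {u v : V} {p : List (E × Bool)} (h : Γ.IsEdgePath u p v)
    {x : E × Bool} (hx : x ∈ p) : Γ.origin x ∈ u :: p.map Γ.terminus := by
  induction p generalizing u with
  | nil => simp at hx
  | cons d p ih =>
    rcases List.mem_cons.1 hx with rfl | hx
    · simp [h.1]
    · exact List.mem_cons_of_mem _ (ih h.2 hx)

lemma IsEdgePath.exists_succ {u v : V} {p : List (E × Bool)} (h : Γ.IsEdgePath u p v)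
    {x : E × Bool} (hx : x ∈ p.dropLast) : ∃ z ∈ p, Γ.terminus x = Γ.origin z := by
  induction p generalizing u with
  | nil => simp at hx
  | cons d p ih =>
    cases p with
    | nil => simp at hx
    | cons b p =>
      rcases List.mem_cons.1 hx with rfl | hx
      · exact ⟨b, by simp, h.2.1.symm⟩
      · obtain ⟨z, hz, hz'⟩ := ih h.2 hx
        exact ⟨z, List.mem_cons_of_mem _ hz, hz'⟩

lemma IsEdgePath.exists_terminus_eq {u v : V} {p : List (E × Bool)} (h : Γ.IsEdgePath u p v)
    (hp : p ≠ []) : ∃ y ∈ p, Γ.terminus y = v := by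
  rcases List.eq_nil_or_concat' p with rfl | ⟨A, z, rfl⟩
  · exact absurd rfl hp
  · obtain ⟨w, -, hw⟩ := isEdgePath_append.1 h
    exact ⟨z, by simp, hw.2⟩

lemma IsEdgePath.nodup_edges {u v : V} {p : List (E × Bool)} (h : Γ.IsEdgePath u p v)
    (hn : (u :: p.map Γ.terminus).Nodup) : (p.map Prod.fst).Nodup := by
  induction p generalizing u with
  | nil => simp
  | cons d p ih =>
    rw [List.map_cons, List.nodup_cons] at hn ⊢
    refine ⟨fun hd => hn.1 ?_, ih h.2 hn.2⟩
    obtain ⟨x, hx, hxd⟩ := List.mem_map.1 hd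
    rw [← h.1]
    rcases eq_or_eq_rev hxd with rfl | rfl
    · exact h.2.origin_mem hx
    · rw [origin_rev]
      exact List.mem_cons_of_mem _ (List.mem_map_of_mem hx)

lemma eq_of_nodup_edges {p : List (E × Bool)} (h : (p.map Prod.fst).Nodup) {x y : E × Bool}
    (hx : x ∈ p) (hy : y ∈ p) (hxy : x.1 = y.1) : x = y :=
  List.inj_on_of_nodup_map h hx hy hxy

lemma next_of_mem {p : List (E × Bool)} (h : (p.map Prod.fst).Nodup) {x y : E × Bool}
    (hx : x ∈ p) (hy : y ∈ p) (hxy : Γ.terminus x = Γ.origin y) : Γ.Next x y := by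
  refine ⟨hxy, ?_⟩
  rintro rfl
  exact rev_ne x (eq_of_nodup_edges h hy hx rfl)

-- Each edge of a cycle has a cyclic predecessor and successor. Backtracking between them is
-- impossible since edges do not repeat, even when the cycle is a single loop.
open Classical in
lemma IsCycle.noLeaves {p : List (E × Bool)} (h : Γ.IsCycle p) :
    Γ.NoLeaves (p.map Prod.fst).toFinset := by
  obtain ⟨hne, ⟨v, hv⟩, -, hn⟩ := h
  obtain ⟨w, hw, hwv⟩ := hv.exists_terminus_eq hne
  have hpred : ∀ x ∈ p, ∃ y ∈ p, Γ.terminus y = Γ.origin x := fun x hx => by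
    rcases List.mem_cons.1 (hv.origin_mem hx) with h | h
    · exact ⟨w, hw, hwv.trans h.symm⟩
    · exact List.mem_map.1 h
  have hsucc : ∀ x ∈ p, ∃ z ∈ p, Γ.terminus x = Γ.origin z := by
    intro x hx
    have hx' : rev x ∈ revPath p := by
      rw [revPath, List.mem_reverse]; exact List.mem_map_of_mem hx
    rcases List.mem_cons.1 (hv.revPath.origin_mem hx') with h | h
    · obtain ⟨a, q, rfl⟩ := List.exists_cons_of_ne_nil hne
      exact ⟨a, by simp, by rw [hv.1, ← h, origin_rev]⟩
    · obtain ⟨y, hy, hyx⟩ := List.mem_map.1 h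
      obtain ⟨z, hz, rfl⟩ : ∃ z ∈ p, rev z = y := by simpa [revPath] using hy
      exact ⟨z, hz, by rw [← terminus_rev, hyx, origin_rev]⟩
  intro d hd
  obtain ⟨x, hx, hxd⟩ : ∃ x ∈ p, x.1 = d.1 := by simpa using hd
  rcases eq_or_eq_rev hxd with rfl | rfl
  · obtain ⟨y, hy, hyd⟩ := hpred d hx
    exact ⟨y, List.mem_toFinset.2 (List.mem_map_of_mem hy), next_of_mem hn hy hx hyd⟩
  · obtain ⟨z, hz, hzd⟩ := hsucc x hx
    exact ⟨rev z, List.mem_toFinset.2 (List.mem_map.2 ⟨z, hz, rfl⟩),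
      (next_of_mem hn hx hz hzd).rev⟩

open Classical in
lemma sum_len_eq_pathLength {p : List (E × Bool)} (h : (p.map Prod.fst).Nodup) :
    ∑ e ∈ (p.map Prod.fst).toFinset, Γ.len e = Γ.pathLength p := by
  rw [List.sum_toFinset _ h, List.map_map]
  rfl

lemma exists_notMem_pair {α : Type*} {s : Set α} (hs : 3 ≤ s.encard) (a b : α) :
    ∃ c ∈ s, c ≠ a ∧ c ≠ b := by
  by_contra! h
  have hsub : s ⊆ {a, b} := fun c hc => by
    by_cases hca : c = a
    · simp [hca]
    · simp [h c hc hca]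
  have h1 : ({a, b} : Set α).encard ≤ 2 :=
    (Set.encard_insert_le _ _).trans (by rw [Set.encard_singleton]; rfl)
  exact absurd (hs.trans ((Set.encard_le_encard hsub).trans h1)) (by decide)

variable {Γ' : Γ.Subgraph}

lemma noLeaves_of_degree (hdeg : ∀ v ∈ Γ'.verts, 2 ≤ Γ'.degree v) {S : Finset E}
    (hS : ∀ e, e ∈ S ↔ e ∈ Γ'.edges) {d : E × Bool} (hd : d.1 ∈ S) :
    Γ.origin d ∈ Γ'.verts ∧ ∃ d₁ : E × Bool, d₁.1 ∈ S ∧ Γ.origin d₁ = Γ.origin d ∧ d₁ ≠ d := by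
  have hv : Γ.origin d ∈ Γ'.verts := by
    unfold origin
    split_ifs
    · exact Γ'.src_mem _ ((hS _).1 hd)
    · exact Γ'.tgt_mem _ ((hS _).1 hd)
  refine ⟨hv, ?_⟩
  have h2 := hdeg _ hv
  obtain ⟨d₁, ⟨h3, h4⟩, h5⟩ := Set.exists_ne_of_one_lt_encard (lt_of_lt_of_le (by decide) h2) d
  exact ⟨d₁, (hS _).2 h3, h4, h5⟩

lemma next_rev_of_origin_eq {d d₁ : E × Bool} (h : Γ.origin d₁ = Γ.origin d) (hne : d₁ ≠ d) :
    Γ.Next (rev d₁) d := ⟨by simp [h], by simpa using hne.symm⟩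

-- At an endpoint of the segment the removal uses up one oriented edge out of at least three, so two
-- remain. An interior vertex has both of its oriented edges on the segment, so no remaining edge
-- meets it. Other vertices keep their degree.
open Classical in
lemma noLeaves_sdiff_segment (hdeg : ∀ v ∈ Γ'.verts, 2 ≤ Γ'.degree v) {S : Finset E}
    (hS : ∀ e, e ∈ S ↔ e ∈ Γ'.edges) {p : List (E × Bool)} (hp : Γ'.IsSegment p) :
    Γ.NoLeaves (S \ (p.map Prod.fst).toFinset) := by
  obtain ⟨hne, hedges, u, v, hpath, hnodup, hu, hv, hint⟩ := hp
  have hn := hpath.nodup_edges hnodup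
  intro d hd
  obtain ⟨hdS, hdp⟩ := Finset.mem_sdiff.1 hd
  have hdp' : ∀ x ∈ p, x.1 ≠ d.1 := fun x hx h =>
    hdp (List.mem_toFinset.2 (List.mem_map.2 ⟨x, hx, h⟩))
  suffices h : ∃ d₁ : E × Bool, d₁.1 ∈ S ∧ (∀ x ∈ p, x.1 ≠ d₁.1) ∧
      Γ.origin d₁ = Γ.origin d ∧ d₁ ≠ d by
    obtain ⟨d₁, h1, h2, h3, h4⟩ := h
    refine ⟨rev d₁, Finset.mem_sdiff.2 ⟨h1, fun h => ?_⟩, next_rev_of_origin_eq h3 h4⟩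
    obtain ⟨x, hx, hx'⟩ := List.mem_map.1 (List.mem_toFinset.1 h)
    exact h2 x hx hx'
  -- Here `b` is the only oriented edge of the segment issuing from the endpoint `w`, so degree
  -- three leaves a choice besides `d` and `b`.
  have branch : ∀ (w : V) (b : E × Bool), 3 ≤ Γ'.degree w → Γ.origin d = w →
      (∀ x ∈ p, (Γ.origin x = w → x = b) ∧ (Γ.terminus x = w → rev x = b)) →
      ∃ d₁ : E × Bool, d₁.1 ∈ S ∧ (∀ x ∈ p, x.1 ≠ d₁.1) ∧
        Γ.origin d₁ = Γ.origin d ∧ d₁ ≠ d := by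
    intro w b hw hdw hb
    obtain ⟨d₁, ⟨h1, h2⟩, h3, h4⟩ := exists_notMem_pair hw d b
    refine ⟨d₁, (hS _).2 h1, fun x hx hxd => h4 ?_, h2.trans hdw.symm, h3⟩
    rcases eq_or_eq_rev hxd with rfl | rfl
    · exact (hb d₁ hx).1 h2
    · exact (hb x hx).2 (by rwa [origin_rev] at h2)
  by_cases hdu : Γ.origin d = u
  · obtain ⟨a, q, rfl⟩ := List.exists_cons_of_ne_nil hne
    rw [List.nodup_cons, List.map_cons] at hnodup
    refine branch u a hu hdu fun x hx => ⟨fun h => ?_, fun h => ?_⟩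
    · rcases List.mem_cons.1 hx with rfl | hx
      · rfl
      · exact absurd (h ▸ hpath.2.origin_mem hx) hnodup.1
    · exact absurd (h ▸ List.mem_map_of_mem (f := Γ.terminus) hx) hnodup.1
  by_cases hdv : Γ.origin d = v
  · rcases List.eq_nil_or_concat' p with rfl | ⟨A, z, rfl⟩
    · exact absurd rfl hne
    obtain ⟨w, hA, hz⟩ := isEdgePath_append.1 hpath
    obtain ⟨rfl, hzv⟩ := hz
    obtain rfl : Γ.terminus z = v := hzv
    have hlast : Γ.terminus z ∉ u :: A.map Γ.terminus := by
      rw [List.map_append, ← List.cons_append, List.nodup_append] at hnodup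
      exact fun h => hnodup.2.2 _ h _ (by simp) rfl
    refine branch _ (rev z) hv hdv fun x hx => ⟨fun h => ?_, fun h => ?_⟩
    · rcases List.mem_append.1 hx with hx | hx
      · exact absurd (h ▸ hA.origin_mem hx) hlast
      · obtain rfl := List.mem_singleton.1 hx
        exact absurd (h ▸ hA.end_mem) hlast
    · rcases List.mem_append.1 hx with hx | hx
      · exact absurd (h ▸ List.mem_cons_of_mem _ (List.mem_map_of_mem (f := Γ.terminus) hx)) hlast
      · rw [List.mem_singleton.1 hx]
  obtain ⟨hdverts, d₁, h1, h2, h3⟩ := noLeaves_of_degree hdeg hS hdS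
  refine ⟨d₁, h1, fun x hx hxd => ?_, h2, h3⟩
  have hmem : Γ.origin d ∈ u :: p.map Γ.terminus := by
    rw [← h2]
    rcases eq_or_eq_rev hxd with rfl | rfl
    · exact hpath.origin_mem hx
    · rw [origin_rev]
      exact List.mem_cons_of_mem _ (List.mem_map_of_mem hx)
  obtain ⟨y, hy, hyd⟩ := List.mem_map.1 ((List.mem_cons.1 hmem).resolve_left hdu)
  have hy' : y ∈ p.dropLast := by
    rcases List.eq_nil_or_concat' p with rfl | ⟨A, z, rfl⟩
    · exact absurd rfl hne
    rcases List.mem_append.1 hy with hy | hy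
    · simpa using hy
    · obtain ⟨w, -, hz⟩ := isEdgePath_append.1 hpath
      rw [List.mem_singleton.1 hy] at hyd
      exact absurd (hyd.symm.trans hz.2) hdv
  obtain ⟨z, hz, hyz⟩ := hpath.exists_succ hy'
  have hdeg2 := hint _ (List.mem_map_of_mem hy')
  -- If `d` started at an interior vertex of the segment, it would be a third oriented edge there
  -- besides the two of the segment, against degree two.
  have hthree : ({rev y, z, d} : Set (E × Bool)) ⊆
      {x | x.1 ∈ Γ'.edges ∧ Γ.origin x = Γ.terminus y} := by
    rintro x (rfl | rfl | rfl)
    · exact ⟨hedges y hy, by simp⟩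
    · exact ⟨hedges _ hz, hyz.symm⟩
    · exact ⟨(hS _).1 hdS, hyd.symm⟩
  have hcard : ({rev y, z, d} : Set (E × Bool)).encard = 3 := by
    rw [Set.encard_eq_three]
    refine ⟨rev y, z, d, ?_, ?_, ?_, rfl⟩
    · exact (next_of_mem hn hy hz hyz).2.symm
    · rintro rfl; exact hdp' y hy rfl
    · rintro rfl; exact hdp' z hz rfl
  have hle := Set.encard_le_encard hthree
  rw [hcard] at hle
  unfold Subgraph.degree at hdeg2
  rw [hdeg2] at hle
  exact absurd hle (by decide)

end MetricGraph

/-! ### Commensurability of cycles and segments -/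

lemma commensurable_of_eq_rat_mul {a b : ℝ} {q : ℚ} (ha : a ≠ 0) (h : a = q * b) :
    Commensurable a b := by
  refine ⟨q.den, q.num, by exact_mod_cast q.den_nz, fun h0 => ha ?_, ?_⟩
  · rw [h, Rat.num_eq_zero.1 h0]; simp
  · rw [h, ← mul_assoc]
    congr 1
    rw [mul_comm]
    exact_mod_cast Rat.mul_den_eq_num q

theorem theorem1p6 {V E : Type*} (Γ : MetricGraph V E) (hlen : Γ.FinitelyManyLengths)
    (Γ' : Γ.Subgraph) (hfin : Γ'.IsFinite)
    (hdeg : ∀ v ∈ Γ'.verts, 2 ≤ Γ'.degree v)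
    (hgirth : Γ.GirthAtLeast (2 * Real.pi))
    (hdist : ∀ x ∈ Γ'.points, ∀ y ∈ Γ'.points, Γ.distance x y ≤ ENNReal.ofReal Real.pi) :
    (∀ p, Γ'.IsCycle p → Commensurable (Γ.pathLength p) Real.pi) ∧
    (∀ p, Γ'.IsSegment p → Commensurable (Γ.pathLength p) Real.pi) := by
  classical
  -- The distance bound passes to every subset of the edges of Γ' because distances are measured in
  -- Γ, not in the subgraph.
  have key : ∀ S : Finset E, (∀ e ∈ S, e ∈ Γ'.edges) → Γ.NoLeaves S →
      ∃ q : ℚ, ∑ e ∈ S, Γ.len e = q * Real.pi := fun S hS hL =>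
    hL.exists_rat Real.pi_pos hgirth fun e he e' he' s hs t ht =>
      hlen.joined (s := ⟨s, hs⟩) (t := ⟨t, ht⟩) Real.pi_pos.le
        (hdist (.interior e ⟨s, hs⟩) (hS e he) (.interior e' ⟨t, ht⟩) (hS e' he'))
  have hpos : ∀ p, p ≠ [] → Γ.pathLength p ≠ 0 := by
    intro p hp
    obtain ⟨a, q, rfl⟩ := List.exists_cons_of_ne_nil hp
    have := Γ.len_pos a.1
    have := Γ.pathLength_nonneg q
    rw [MetricGraph.pathLength_cons]
    positivity
  refine ⟨fun p hp => ?_, fun p hp => ?_⟩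
  · obtain ⟨q, hq⟩ := key _ (fun e he => by
      obtain ⟨x, hx, rfl⟩ := List.mem_map.1 (List.mem_toFinset.1 he)
      exact hp.2 x hx) hp.1.noLeaves
    rw [MetricGraph.sum_len_eq_pathLength hp.1.2.2.2] at hq
    exact commensurable_of_eq_rat_mul (hpos p hp.1.1) hq
  · have hS : ∀ e, e ∈ hfin.2.toFinset ↔ e ∈ Γ'.edges := fun e => by simp
    obtain ⟨q₁, hq₁⟩ := key _ (fun e he => (hS e).1 he) fun d hd => by
      obtain ⟨-, d₁, h1, h2, h3⟩ := MetricGraph.noLeaves_of_degree hdeg hS hd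
      exact ⟨MetricGraph.rev d₁, h1, MetricGraph.next_rev_of_origin_eq h2 h3⟩
    obtain ⟨q₂, hq₂⟩ := key _ (fun e he => (hS e).1 (Finset.mem_sdiff.1 he).1)
      (MetricGraph.noLeaves_sdiff_segment hdeg hS hp)
    obtain ⟨hne, hedges, u, v, hpath, hnodup, -⟩ := hp
    have hsub : (p.map Prod.fst).toFinset ⊆ hfin.2.toFinset := fun e he => by
      obtain ⟨x, hx, rfl⟩ := List.mem_map.1 (List.mem_toFinset.1 he)
      exact (hS _).2 (hedges x hx)
    have hsum := Finset.sum_sdiff (f := Γ.len) hsub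
    rw [MetricGraph.sum_len_eq_pathLength (hpath.nodup_edges hnodup), hq₁, hq₂] at hsum
    refine commensurable_of_eq_rat_mul (q := q₁ - q₂) (hpos p hne) ?_
    push_cast
    linarith
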